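/- A locale $X$ is \emph{overt} if every open is a join of positive opens, where an open $a$ is positive if every family $A$ of opens with $a\le\bigvee A$ is inhabited; $\mathbf{OLoc}$ denotes the category of overt locales and locale morphisms. A \emph{pre-uniform locale} is an overt locale $X$ with a filter $\mathcal E$ on $\mathcal O(X\times X)$ such that for each $E\in\mathcal E$: (i) $\Delta^*(E)=1$ for the diagonal $\Delta\colon X\to X\times X$; (ii) $E$ is the image, under the automorphism of $\mathcal O(X\times X)$ swapping the factors, of some $E'\in\mathcal E$; (iii) $F\circ F\le E$ for some $F\in\mathcal E$. Here $F\circ E=(\pi_{13})_!(\pi_{12}^*E\wedge\pi_{23}^*F)$, where $\pi_{ij}\colon X\times X\times X\to X\times X$ are the projections and $(\pi_{13})_!$ is the left adjoint of $\pi_{13}^*$. A morphism $(X,\mathcal E)\to(Y,\mathcal F)$ is a locale morphism $f\colon X\to Y$ with $(f\times f)^*(F)\in\mathcal E$ for all $F\in\mathcal F$. Write $a\vartriangleleft b$ if $E\circ(a\oplus a)\le b\oplus b$ for some $E\in\mathcal E$, where $a\oplus b=\pi_1^*a\wedge\pi_2^*b$. A pre-uniform locale is \emph{uniform} if $b=\bigvee_{a\vartriangleleft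 b}a$ for every open $b$. Let $\mathbf{PUnifLoc}$ be the category of pre-uniform locales and $\mathbf{UnifLoc}$ its full subcategory of uniform locales. \textbf{Proposition.} (1) For every pre-uniform locale $X$, the map $r\colon\mathcal OX\to\mathcal OX$, $r(b)=\bigvee_{a\vartriangleleft b}a$, is a conucleus (an interior operator preserving finite meets), and the set $R=\{b : b=\bigvee_{a\vartriangleleft b}a\}$ of its fixed points is a subframe of $\mathcal OX$. (2) $\mathbf{UnifLoc}$ is a reflective subcategory of $\mathbf{PUnifLoc}$. The reflector $\Upsilon$ can be described as follows: for every $X$ the unit $\upsilon_X\colon X\to\Upsilon X$ identifies $\mathcal O\Upsilon X$ with the subframe $R$, i.e. $\upsilon_X^*$ is injective with image $R$, and $\Upsilon X$ carries the final uniformity, i.e. $\upsilon_X$ is final with respect to the forgetful functor $\mathbf{PUnifLoc}\to\mathbf{OLoc}$. (3) The forgetful functor $\mathbf{PUnifLoc}\to\mathbf{OLoc}$ is topological: every structured source $(f_i\colon Y\to X_i)_{i\in I}$, with the $X_i$ pre-uniform locales, has a unique initial lift. (4) $\mathbf{OLoc}$, $\mathbf{PUnifLoc}$ and $\mathbf{UnifLoc}$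 are complete and cocomplete. -/

import Mathlib

universe u v w v₁ v₂ u₁ u₂

open CategoryTheory CategoryTheory.Limits

namespace PointfreeUniformity

/-! ### The product of two locales

If `L` and `M` are the frames of opens of two locales, the frame of opens of the product locale
is the coproduct of the frames `L` and `M`. It is constructed as the frame of all
down-closed subsets of `L × M` which are closed under arbitrary joins in either coordinate. -/

section Product

variable {L M N P Q : Type*} [Order.Frame L] [Order.Frame M] [Order.Frame N] [Order.Frame P]
  [Order.Frame Q]

/-- A lower set of `L × M` which is closed under arbitrary joins in either coordinate. -/
structure IsCIdeal (U : LowerSet (L × M)) : Prop where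
  left : ∀ (A : Set L) (b : M), (∀ a ∈ A, (a, b) ∈ U) → (sSup A, b) ∈ U
  right : ∀ (a : L) (B : Set M), (∀ b ∈ B, (a, b) ∈ U) → (a, sSup B) ∈ U

theorem mem_himp_iff {U V : LowerSet (L × M)} {p : L × M} :
    p ∈ U ⇨ V ↔ ∀ q ≤ p, q ∈ U → q ∈ V := by
  rw [← LowerSet.Iic_le, le_himp_iff]
  exact ⟨fun h q hq hU => h ⟨hq, hU⟩, fun h q hq => h q hq.1 hq.2⟩

variable (L M) in
/-- The lower sets closed under joins in either coordinate form a sublocale of the frame of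
lower sets of `L × M`; in particular they form a frame. -/
def cIdeals : Sublocale (LowerSet (L × M)) where
  carrier := {U | IsCIdeal U}
  sInf_mem' s hs :=
    { left := fun A b h => by
        simp only [LowerSet.mem_sInf_iff] at h ⊢
        exact fun U hU => (hs hU).left A b fun a ha => h a ha U hU
      right := fun a B h => by
        simp only [LowerSet.mem_sInf_iff] at h ⊢
        exact fun U hU => (hs hU).right a B fun b hb => h b hb U hU }
  himp_mem' U V hV :=
    { left := fun A b h => by
        simp only [mem_himp_iff] at h ⊢
        rintro ⟨x, y⟩ ⟨hx, hy⟩ hU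
        have hx' : x = sSup ((fun a => x ⊓ a) '' A) := by
          rw [sSup_image, ← inf_sSup_eq]; exact (inf_eq_left.2 hx).symm
        rw [hx']
        refine hV.left _ _ ?_
        rintro _ ⟨a, ha, rfl⟩
        exact h a ha _ ⟨inf_le_right, hy⟩ (U.lower (Prod.mk_le_mk.2 ⟨inf_le_left, le_rfl⟩) hU)
      right := fun a B h => by
        simp only [mem_himp_iff] at h ⊢
        rintro ⟨x, y⟩ ⟨hx, hy⟩ hU
        have hy' : y = sSup ((fun b => y ⊓ b) '' B) := by
          rw [sSup_image, ← inf_sSup_eq]; exact (inf_eq_left.2 hy).symm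
        rw [hy']
        refine hV.right _ _ ?_
        rintro _ ⟨b, hb, rfl⟩
        exact h b hb _ ⟨hx, inf_le_right⟩ (U.lower (Prod.mk_le_mk.2 ⟨le_rfl, inf_le_left⟩) hU) }

variable (L M) in
/-- The frame of opens of the product of the locales with frames of opens `L` and `M`. -/
abbrev ProdOpens : Type _ := cIdeals L M

/-- The open rectangle `a ⊕ b`: the smallest element of the product frame containing `(a, b)`. -/
def rect (a : L) (b : M) : ProdOpens L M := (cIdeals L M).restrict (LowerSet.Iic (a, b))

theorem rect_le_iff {a : L} {b : M} {C : ProdOpens L M} :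
    rect a b ≤ C ↔ (a, b) ∈ (C : LowerSet (L × M)) := by
  rw [← LowerSet.Iic_le]
  exact (cIdeals L M).giRestrict.gc _ _

theorem isCIdeal (C : ProdOpens L M) : IsCIdeal (C : LowerSet (L × M)) := C.2

theorem rect_inf_rect (a a' : L) (b b' : M) :
    rect a b ⊓ rect a' b' = rect (a ⊓ a') (b ⊓ b') := by
  unfold rect
  rw [← map_inf]
  congr 1
  ext ⟨x, y⟩
  simp only [LowerSet.coe_inf, LowerSet.coe_Iic, Set.mem_inter_iff, Set.mem_Iic, Prod.mk_le_mk,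
    le_inf_iff]
  tauto

theorem rect_top_top : rect (⊤ : L) (⊤ : M) = ⊤ := by
  refine top_le_iff.1 fun p _ => ?_
  exact (rect ⊤ ⊤ : ProdOpens L M).1.lower ⟨le_top, le_top⟩ (rect_le_iff.1 le_rfl)

theorem rect_mono {a a' : L} {b b' : M} (h : a ≤ a') (h' : b ≤ b') : rect a b ≤ rect a' b' :=
  rect_le_iff.2 ((rect a' b').1.lower ⟨h, h'⟩ (rect_le_iff.1 le_rfl))

/-- Every open of the product is the join of the rectangles below it. -/
theorem eq_iSup_rect (C : ProdOpens L M) :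
    C = ⨆ p ∈ (C : LowerSet (L × M)), rect p.1 p.2 := by
  refine le_antisymm (fun p hp => ?_) (iSup₂_le fun p hp => rect_le_iff.2 hp)
  exact rect_le_iff.1 (le_iSup₂_of_le p hp le_rfl)

variable (L M) in
/-- The frame homomorphism `π₁^*` of the first product projection. -/
def fstPullback : FrameHom L (ProdOpens L M) where
  toFun a := rect a ⊤
  map_inf' a a' := by rw [rect_inf_rect, inf_top_eq]
  map_top' := rect_top_top
  map_sSup' A := by
    refine le_antisymm (rect_le_iff.2 ?_) (sSup_le ?_)
    · exact (isCIdeal _).left A ⊤ fun a ha =>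
        rect_le_iff.1 (le_sSup ⟨a, ha, rfl⟩)
    · rintro _ ⟨a, ha, rfl⟩
      exact rect_mono (le_sSup ha) le_rfl

variable (L M) in
/-- The frame homomorphism `π₂^*` of the second product projection. -/
def sndPullback : FrameHom M (ProdOpens L M) where
  toFun b := rect ⊤ b
  map_inf' b b' := by rw [rect_inf_rect, inf_top_eq]
  map_top' := rect_top_top
  map_sSup' B := by
    refine le_antisymm (rect_le_iff.2 ?_) (sSup_le ?_)
    · exact (isCIdeal _).right ⊤ B fun b hb =>
        rect_le_iff.1 (le_sSup ⟨b, hb, rfl⟩)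
    · rintro _ ⟨b, hb, rfl⟩
      exact rect_mono le_rfl (le_sSup hb)

theorem rect_eq (a : L) (b : M) : rect a b = fstPullback L M a ⊓ sndPullback L M b := by
  change _ = rect a ⊤ ⊓ rect ⊤ b
  rw [rect_inf_rect, inf_top_eq, top_inf_eq]

/-- The elements whose rectangle is sent below `n`. -/
def liftRight (f : FrameHom L N) (g : FrameHom M N) (n : N) : ProdOpens L M :=
  ⟨⟨{p | f p.1 ⊓ g p.2 ≤ n}, fun _ _ hqp hp =>
      (inf_le_inf (OrderHomClass.mono f hqp.1) (OrderHomClass.mono g hqp.2)).trans hp⟩,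
    { left := fun A b h => by
        change f (sSup A) ⊓ g b ≤ n
        rw [map_sSup, sSup_inf_eq]
        simp only [Set.mem_image, iSup_exists, iSup_le_iff]
        rintro _ a ⟨ha, rfl⟩
        exact h a ha
      right := fun a B h => by
        change f a ⊓ g (sSup B) ≤ n
        rw [map_sSup, inf_sSup_eq]
        simp only [Set.mem_image, iSup_exists, iSup_le_iff]
        rintro _ b ⟨hb, rfl⟩
        exact h b hb }⟩

theorem lift_gc (f : FrameHom L N) (g : FrameHom M N) :
    GaloisConnection (fun C : ProdOpens L M => ⨆ p ∈ (C : LowerSet (L × M)), f p.1 ⊓ g p.2)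
      (liftRight f g) := fun C n => by
  change (⨆ p ∈ (C : LowerSet (L × M)), f p.1 ⊓ g p.2) ≤ n ↔ _
  rw [iSup₂_le_iff]
  exact Iff.rfl

/-- The frame homomorphism `(f, g)^*` of the pairing of two locale maps with common domain. -/
def lift (f : FrameHom L N) (g : FrameHom M N) : FrameHom (ProdOpens L M) N where
  toFun C := ⨆ p ∈ (C : LowerSet (L × M)), f p.1 ⊓ g p.2
  map_inf' C D := by
    refine le_antisymm (le_inf ((lift_gc f g).monotone_l inf_le_left)
      ((lift_gc f g).monotone_l inf_le_right)) ?_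
    rw [iSup₂_inf_eq]
    refine iSup₂_le fun p hp => ?_
    rw [inf_iSup₂_eq]
    refine iSup₂_le fun q hq => ?_
    refine le_iSup₂_of_le (p ⊓ q) ⟨C.1.lower inf_le_left hp, D.1.lower inf_le_right hq⟩ ?_
    rw [Prod.fst_inf, Prod.snd_inf, map_inf, map_inf, inf_inf_inf_comm]
  map_top' := by
    refine top_le_iff.1 (le_iSup₂_of_le (⊤, ⊤) trivial ?_)
    simp
  map_sSup' S := by rw [(lift_gc f g).l_sSup, sSup_image]

theorem lift_rect (f : FrameHom L N) (g : FrameHom M N) (a : L) (b : M) :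
    lift f g (rect a b) = f a ⊓ g b := by
  refine le_antisymm ?_ (le_iSup₂_of_le (a, b) (rect_le_iff.1 le_rfl) le_rfl)
  refine (lift_gc f g).l_le (rect_le_iff.2 ?_)
  exact le_rfl (a := f a ⊓ g b)

theorem lift_fst (f : FrameHom L N) (g : FrameHom M N) (a : L) :
    lift f g (fstPullback L M a) = f a := by
  change lift f g (rect a ⊤) = _
  rw [lift_rect, map_top, inf_top_eq]

theorem lift_snd (f : FrameHom L N) (g : FrameHom M N) (b : M) :
    lift f g (sndPullback L M b) = g b := by
  change lift f g (rect ⊤ b) = _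
  rw [lift_rect, map_top, top_inf_eq]

/-- Frame homomorphisms out of the product frame are determined on the two factors, so that,
with `lift_fst` and `lift_snd`, it is the coproduct of frames. -/
theorem prodOpens_hom_ext {h k : FrameHom (ProdOpens L M) N}
    (h₁ : ∀ a, h (fstPullback L M a) = k (fstPullback L M a))
    (h₂ : ∀ b, h (sndPullback L M b) = k (sndPullback L M b)) : h = k := by
  ext C
  rw [eq_iSup_rect C]
  simp only [map_iSup, rect_eq, map_inf, h₁, h₂]

/-- The frame homomorphism `(f × g)^*` of a product of two locale maps. -/
def prodMap (f : FrameHom L P) (g : FrameHom M Q) : FrameHom (ProdOpens L M) (ProdOpens P Q) :=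
  lift ((fstPullback P Q).comp f) ((sndPullback P Q).comp g)

theorem prodMap_id : prodMap (FrameHom.id L) (FrameHom.id M) = FrameHom.id (ProdOpens L M) :=
  prodOpens_hom_ext (fun a => lift_fst _ _ a) (fun b => lift_snd _ _ b)

theorem prodMap_comp {P' Q' : Type*} [Order.Frame P'] [Order.Frame Q'] (f : FrameHom L P)
    (g : FrameHom M Q) (f' : FrameHom P P') (g' : FrameHom Q Q') :
    prodMap (f'.comp f) (g'.comp g) = (prodMap f' g').comp (prodMap f g) := by
  refine prodOpens_hom_ext (fun a => ?_) (fun b => ?_)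
  · simp only [prodMap, FrameHom.comp_apply, lift_fst]
  · simp only [prodMap, FrameHom.comp_apply, lift_snd]

end Product

/-! ### Open relations on a locale -/

section Relations

variable (L : Type*) [Order.Frame L]

/-- The frame homomorphism of the diagonal `X ⟶ X × X`. -/
def diagPullback : FrameHom (ProdOpens L L) L := lift (FrameHom.id L) (FrameHom.id L)

/-- The frame homomorphism of the map `X × X ⟶ X × X` sending `(x, y)` to `(y, x)`. -/
def swapPullback : FrameHom (ProdOpens L L) (ProdOpens L L) :=
  lift (sndPullback L L) (fstPullback L L)

/-- The frame of opens of `X × (X × X)`. -/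
abbrev TripleOpens : Type _ := ProdOpens L (ProdOpens L L)

/-- The frame homomorphism of `(x, y, z) ↦ (x, y)`. -/
def pullback₁₂ : FrameHom (ProdOpens L L) (TripleOpens L) :=
  lift (fstPullback L (ProdOpens L L))
    ((sndPullback L (ProdOpens L L)).comp (fstPullback L L))

/-- The frame homomorphism of `(x, y, z) ↦ (y, z)`. -/
def pullback₂₃ : FrameHom (ProdOpens L L) (TripleOpens L) :=
  sndPullback L (ProdOpens L L)

/-- The frame homomorphism of `(x, y, z) ↦ (x, z)`. -/
def pullback₁₃ : FrameHom (ProdOpens L L) (TripleOpens L) :=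
  lift (fstPullback L (ProdOpens L L))
    ((sndPullback L (ProdOpens L L)).comp (sndPullback L L))

variable {L}

/-- Existential quantification `{(x, z) | ∃ y, (x, y, z) ∈ T}` along the projection
`(x, y, z) ↦ (x, z)`: the value at `T` of the left adjoint of `pullback₁₃`. -/
def existsMiddle (T : TripleOpens L) : ProdOpens L L :=
  sInf {G | T ≤ pullback₁₃ L G}

/-- The composite `F ∘ E = {(x, z) | ∃ y, (x, y) ∈ E ∧ (y, z) ∈ F}` of open relations. -/
def relComp (F E : ProdOpens L L) : ProdOpens L L :=
  existsMiddle (pullback₁₂ L E ⊓ pullback₂₃ L F)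

variable (L) in
/-- A uniformity, given by a filter of open entourages, on the locale with frame of opens `L`.
No compatibility with the frame `L` is required. -/
@[ext]
structure Uniformity where
  entourages : Order.PFilter (ProdOpens L L)
  diag_eq_top : ∀ E ∈ entourages, diagPullback L E = ⊤
  exists_swap : ∀ E ∈ entourages, ∃ E' ∈ entourages, E = swapPullback L E'
  exists_comp_le : ∀ E ∈ entourages, ∃ F ∈ entourages, relComp F F ≤ E

/-- The uniformly below relation on opens. -/
def Uniformity.UniformlyBelow (𝓔 : Uniformity L) (a b : L) : Prop :=
  ∃ E ∈ 𝓔.entourages, relComp E (rect a a) ≤ rect b b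

/-- A uniformity is admissible if every open is the join of the opens uniformly below it. -/
def Uniformity.IsAdmissible (𝓔 : Uniformity L) : Prop :=
  ∀ b : L, b = sSup {a | 𝓔.UniformlyBelow a b}

/-- The operator sending `b` to the join of the opens uniformly below `b`. -/
def Uniformity.core (𝓔 : Uniformity L) (b : L) : L := sSup {a | 𝓔.UniformlyBelow a b}

/-- A conucleus on a frame is an interior operator which preserves finite meets. -/
structure IsConucleus (r : L → L) : Prop where
  monotone : Monotone r
  le_self : ∀ b, r b ≤ b
  idempotent : ∀ b, r (r b) = r b
  map_top : r ⊤ = ⊤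
  map_inf : ∀ a b, r (a ⊓ b) = r a ⊓ r b

/-- A subframe is a subset which is closed under finite meets and arbitrary joins. -/
structure IsSubframe (R : Set L) : Prop where
  top_mem : ⊤ ∈ R
  inf_mem : ∀ a ∈ R, ∀ b ∈ R, a ⊓ b ∈ R
  sSup_mem : ∀ A ⊆ R, sSup A ∈ R

/-- An open is positive if every cover of it is inhabited. -/
def IsPositive (a : L) : Prop := ∀ A : Set L, a ≤ sSup A → A.Nonempty

end Relations

/-! ### The categories of overt, pre-uniform and uniform locales -/

/-- The frame homomorphism `f^*` of a morphism of locales `f`. -/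
def localePullback {X Y : Locale.{u}} (f : X ⟶ Y) : FrameHom Y X := (Quiver.Hom.unop f).hom

/-- A locale is overt if it has a base of positive opens. -/
def IsOvert : ObjectProperty Locale.{u} :=
  fun X => ∀ a : X, a = sSup {b : X | b ≤ a ∧ IsPositive b}

/-- The category of overt locales. -/
abbrev OLoc : Type (u + 1) := IsOvert.{u}.FullSubcategory

namespace OLoc

/-- The frame of opens of an overt locale. -/
abbrev Opens (X : OLoc.{u}) : Type u := X.obj

/-- The frame homomorphism `f^*` of a morphism of overt locales `f`. -/
def pullback {X Y : OLoc.{u}} (f : X ⟶ Y) : FrameHom Y.Opens X.Opens := localePullback f.hom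

theorem pullback_id (X : OLoc.{u}) : pullback (𝟙 X) = FrameHom.id X.Opens := rfl

theorem pullback_comp {X Y Z : OLoc.{u}} (f : X ⟶ Y) (g : Y ⟶ Z) :
    pullback (f ≫ g) = (pullback f).comp (pullback g) := rfl

end OLoc

/-- A pre-uniform locale: an overt locale equipped with a uniformity. -/
structure PUnifLoc : Type (u + 1) where
  toOLoc : OLoc.{u}
  uniformity : Uniformity toOLoc.Opens

namespace PUnifLoc

/-- A morphism of pre-uniform locales is a morphism `f` of the underlying locales such that
`(f × f)^*` sends entourages to entourages. -/
@[ext]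
structure Hom (X Y : PUnifLoc.{u}) : Type u where
  toHom : X.toOLoc ⟶ Y.toOLoc
  prodMap_mem : ∀ F ∈ Y.uniformity.entourages,
    prodMap (OLoc.pullback toHom) (OLoc.pullback toHom) F ∈ X.uniformity.entourages

instance : Category.{u} PUnifLoc.{u} where
  Hom := Hom
  id X := ⟨𝟙 X.toOLoc, fun F hF => by rwa [OLoc.pullback_id, prodMap_id]⟩
  comp f g := ⟨f.toHom ≫ g.toHom, fun F hF => by
    rw [OLoc.pullback_comp, prodMap_comp]
    exact f.prodMap_mem _ (g.prodMap_mem F hF)⟩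

/-- The functor sending a pre-uniform locale to its underlying overt locale. -/
def forget : PUnifLoc.{u} ⥤ OLoc.{u} where
  obj X := X.toOLoc
  map f := f.toHom

/-- The frame of opens of a pre-uniform locale. -/
abbrev Opens (X : PUnifLoc.{u}) : Type u := X.toOLoc.Opens

/-- The frame homomorphism `f^*` of a morphism of pre-uniform locales `f`. -/
abbrev pullback {X Y : PUnifLoc.{u}} (f : X ⟶ Y) : FrameHom Y.Opens X.Opens :=
  OLoc.pullback (forget.map f)

end PUnifLoc

/-- A uniform locale is a pre-uniform locale whose uniformity is admissible. -/
def IsUniform : ObjectProperty PUnifLoc.{u} := fun X => X.uniformity.IsAdmissible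

/-- The category of uniform locales, a full subcategory of the pre-uniform locales. -/
abbrev UnifLoc : Type (u + 1) := IsUniform.{u}.FullSubcategory

/-- The inclusion of uniform locales in pre-uniform locales. -/
abbrev UnifLoc.incl : UnifLoc.{u} ⥤ PUnifLoc.{u} := IsUniform.{u}.ι

/-! ### Topological functors -/

section Topological

variable {C : Type u₁} [Category.{v₁} C] {D : Type u₂} [Category.{v₂} D] (U : C ⥤ D)

/-- A source `(f i : A ⟶ X i)` is initial with respect to `U` if every morphism
`h : U Z ⟶ U A`, all of whose composites with the `U (f i)` underlie given morphisms
`g i : Z ⟶ X i`, underlies a unique morphism `Z ⟶ A` compatible with the `g i`. -/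
def IsInitialSource {I : Type w} {A : C} {X : I → C} (f : ∀ i, A ⟶ X i) : Prop :=
  ∀ (Z : C) (g : ∀ i, Z ⟶ X i) (h : U.obj Z ⟶ U.obj A),
    (∀ i, U.map (g i) = h ≫ U.map (f i)) →
      ∃! k : Z ⟶ A, U.map k = h ∧ ∀ i, k ≫ f i = g i

/-- A morphism `f : A ⟶ B` is final with respect to `U` if every morphism `h : U B ⟶ U Z` whose
composite with `U f` underlies a given morphism `g : A ⟶ Z` underlies a unique morphism
`B ⟶ Z` compatible with `g`. -/
def IsFinalMorphism {A B : C} (f : A ⟶ B) : Prop :=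
  ∀ (Z : C) (g : A ⟶ Z) (h : U.obj B ⟶ U.obj Z),
    U.map g = U.map f ≫ h → ∃! k : B ⟶ Z, U.map k = h ∧ f ≫ k = g

/-- An initial lift of a structured source `(f i : Y ⟶ U (X i))`. -/
structure InitialLift {I : Type w} (X : I → C) (Y : D) (f : ∀ i, Y ⟶ U.obj (X i)) where
  obj : C
  obj_eq : U.obj obj = Y
  hom : ∀ i, obj ⟶ X i
  map_hom : ∀ i, U.map (hom i) = eqToHom obj_eq ≫ f i
  isInitial : IsInitialSource U hom

/-- A functor is topological if every structured source has a unique initial lift. -/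
def IsTopologicalFunctor : Prop :=
  ∀ (I : Type w) (X : I → C) (Y : D) (f : ∀ i, Y ⟶ U.obj (X i)),
    Nonempty (Unique (InitialLift U X Y f))

end Topological

end PointfreeUniformity

open PointfreeUniformity

namespace PointfreeUniformity

/-! Everything rests on a calculus of rectangles. Classically, an open is positive exactly when it
is nonzero, so every locale is overt and `b ≠ ⊥` can play the role of "b has a point". An open
relation is a join of rectangles, and `relComp_le_iff` describes composition as with ordinary
relations: rectangles of `E` and `F` compose when their middle sides overlap.

Uniform belowness of `a` and `b` then means that one explicit relation, `nearBound a b`, is an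
entourage (`uniformlyBelow_iff`). Closure under meets follows from the filter property and
interpolation from splitting an entourage as `F ∘ F`; together they make the core a conucleus, whose
fixed points form a subframe `R`.

For the reflection, let `i` be the inclusion of `R`. The uniformity on `R` is generated by the
restrictions `comapRel i E` of entourages. Two estimates carry the argument. Restriction loses
little: if `F` is symmetric with threefold composite below `E`, every rectangle of `F` enlarges to a
rectangle of fixed opens inside `E` (`prodMap_comapRel_mem`), so `i` is uniform. Conversely,
restricting the image of a reflexive `K` gives at most its threefold composite
(`comapRel_prodMap_le`), which yields finality. A uniform map into a uniform locale has its inverse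
images in `R`, hence factors through the unit.

Initial lifts carry the uniformity generated by the inverse images of entourages. Frames have limits
(compatible families) and colimits (generated subframes of a large product), which dualize to
locales; initial lifts transfer both to pre-uniform locales, and reflectivity passes them on to
uniform ones. -/

/-! ### Frames embedded as subframes -/

section Subframe

variable {α : Type*} {β : Type*} [Order.Frame β]

/-- The frame structure on a type which is embedded in a frame as a subframe. -/
@[reducible]
noncomputable def frameOfInjective (e : α → β) (he : Function.Injective e)
    (hr : IsSubframe (Set.range e)) : Order.Frame α :=
  letI : PartialOrder α := PartialOrder.lift e he
  letI : SupSet α := ⟨fun A => (hr.sSup_mem (e '' A) (Set.image_subset_range _ _)).choose⟩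
  have hs : ∀ A : Set α, e (sSup A) = sSup (e '' A) := fun A =>
    (hr.sSup_mem (e '' A) (Set.image_subset_range _ _)).choose_spec
  letI : CompleteLattice α := completeLatticeOfSup α fun A =>
    ⟨fun a ha => show e a ≤ e (sSup A) from (hs A).symm ▸ le_sSup ⟨a, ha, rfl⟩,
      fun b hb => show e (sSup A) ≤ e b from (hs A).symm ▸ sSup_le (by
        rintro _ ⟨a, ha, rfl⟩
        exact hb ha)⟩
  -- The meet of `α` was derived from its joins; it agrees with the meet of `β` because the latter
  -- lies in the range of `e`.
  have hi : ∀ a b : α, e (a ⊓ b) = e a ⊓ e b := fun a b => by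
    obtain ⟨c, hc⟩ := hr.inf_mem _ ⟨a, rfl⟩ _ ⟨b, rfl⟩
    have hca : c ≤ a := show e c ≤ e a from hc.le.trans inf_le_left
    have hcb : c ≤ b := show e c ≤ e b from hc.le.trans inf_le_right
    exact le_antisymm (le_inf (show a ⊓ b ≤ a from inf_le_left) (show a ⊓ b ≤ b from inf_le_right))
      (hc ▸ show c ≤ a ⊓ b from le_inf hca hcb)
  Order.Frame.ofMinimalAxioms
    { inf_sSup_le_iSup_inf := fun a A => by
        change e _ ≤ e _
        rw [hi, hs, inf_sSup_eq]
        refine iSup₂_le ?_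
        rintro _ ⟨b, hb, rfl⟩
        rw [← hi]
        exact show a ⊓ b ≤ _ from le_iSup₂_of_le b hb le_rfl }

/-- The inclusion of a type which is embedded in a frame as a subframe. -/
noncomputable def homOfInjective (e : α → β) (he : Function.Injective e)
    (hr : IsSubframe (Set.range e)) :
    letI := frameOfInjective e he hr
    FrameHom α β :=
  letI := frameOfInjective e he hr
  { toFun := e
    map_inf' := fun a b => by
      obtain ⟨c, hc⟩ := hr.inf_mem _ ⟨a, rfl⟩ _ ⟨b, rfl⟩
      have hca : c ≤ a := show e c ≤ e a from hc.le.trans inf_le_left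
      have hcb : c ≤ b := show e c ≤ e b from hc.le.trans inf_le_right
      exact le_antisymm
        (le_inf (show a ⊓ b ≤ a from inf_le_left) (show a ⊓ b ≤ b from inf_le_right))
        (hc ▸ show c ≤ a ⊓ b from le_inf hca hcb)
    map_top' := by
      obtain ⟨c, hc⟩ := hr.top_mem
      exact top_le_iff.1 (hc ▸ show c ≤ ⊤ from le_top)
    map_sSup' := fun A =>
      (hr.sSup_mem (e '' A) (Set.image_subset_range _ _)).choose_spec }

theorem le_iff_of_injective [Order.Frame α] {i : FrameHom α β} (hi : Function.Injective i)
    {a b : α} : i a ≤ i b ↔ a ≤ b := by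
  rw [← inf_eq_left, ← map_inf, hi.eq_iff, inf_eq_left]

theorem eq_bot_iff_of_injective [Order.Frame α] {i : FrameHom α β} (hi : Function.Injective i)
    {a : α} : i a = ⊥ ↔ a = ⊥ := by
  rw [← map_bot i, hi.eq_iff]

/-- A frame homomorphism whose values lie in a subframe factors through the subframe. -/
noncomputable def codRestrict {γ : Type*} [Order.Frame α] [Order.Frame γ] (i : FrameHom α β)
    (hi : Function.Injective i) (f : FrameHom γ β) (hf : ∀ c, f c ∈ Set.range i) :
    FrameHom γ α where
  toFun c := (hf c).choose
  map_inf' a b := hi <| (hf _).choose_spec.trans <| by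
    rw [map_inf, map_inf i]
    exact congrArg₂ _ (hf a).choose_spec.symm (hf b).choose_spec.symm
  map_top' := hi <| (hf _).choose_spec.trans <| by rw [map_top, map_top]
  map_sSup' A := hi <| (hf _).choose_spec.trans <| by
    rw [map_sSup, map_sSup, Set.image_image]
    exact congrArg sSup (Set.image_congr fun a _ => (hf a).choose_spec.symm)

theorem codRestrict_spec {γ : Type*} [Order.Frame α] [Order.Frame γ] (i : FrameHom α β)
    (hi : Function.Injective i) (f : FrameHom γ β) (hf : ∀ c, f c ∈ Set.range i) (c : γ) :
    i (codRestrict i hi f hf c) = f c := (hf c).choose_spec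

end Subframe

/-! ### Open relations -/

section Relations

variable {L M : Type*} [Order.Frame L] [Order.Frame M]

/-- The set on the right is already closed under joins in each coordinate, so it is the closure of
the principal lower set. The two degenerate cases are forced by empty joins. -/
theorem mem_rect_iff {a x : L} {b y : M} :
    (x, y) ∈ (rect a b : LowerSet (L × M)) ↔ x = ⊥ ∨ y = ⊥ ∨ x ≤ a ∧ y ≤ b := by
  constructor
  · let R : ProdOpens L M := ⟨⟨{p | p.1 = ⊥ ∨ p.2 = ⊥ ∨ p.1 ≤ a ∧ p.2 ≤ b}, by
      rintro p q hqp (h | h | h)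
      · exact Or.inl (le_bot_iff.1 (h ▸ hqp.1))
      · exact Or.inr (Or.inl (le_bot_iff.1 (h ▸ hqp.2)))
      · exact Or.inr (Or.inr ⟨hqp.1.trans h.1, hqp.2.trans h.2⟩)⟩,
      { left := fun A y h => by
          change sSup A = ⊥ ∨ y = ⊥ ∨ sSup A ≤ a ∧ y ≤ b
          by_cases hy : y = ⊥
          · exact Or.inr (Or.inl hy)
          by_cases hA : sSup A = ⊥
          · exact Or.inl hA
          have h' : ∀ x ∈ A, x = ⊥ ∨ x ≤ a ∧ y ≤ b := fun x hx =>
            (h x hx).imp_right fun h => h.resolve_left hy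
          refine Or.inr (Or.inr ⟨sSup_le fun x hx => ?_, ?_⟩)
          · exact (h' x hx).elim (fun h => h ▸ bot_le) And.left
          · by_contra hyb
            exact hA (sSup_eq_bot.2 fun x hx => (h' x hx).resolve_right fun h => hyb h.2)
        right := fun x B h => by
          change x = ⊥ ∨ sSup B = ⊥ ∨ x ≤ a ∧ sSup B ≤ b
          by_cases hx : x = ⊥
          · exact Or.inl hx
          by_cases hB : sSup B = ⊥
          · exact Or.inr (Or.inl hB)
          have h' : ∀ y ∈ B, y = ⊥ ∨ x ≤ a ∧ y ≤ b := fun y hy => (h y hy).resolve_left hx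
          refine Or.inr (Or.inr ⟨?_, sSup_le fun y hy => ?_⟩)
          · by_contra hxa
            exact hB (sSup_eq_bot.2 fun y hy => (h' y hy).resolve_right fun h => hxa h.1)
          · exact (h' y hy).elim (fun h => h ▸ bot_le) And.right }⟩
    have hR : rect a b ≤ R := rect_le_iff.2 (Or.inr (Or.inr ⟨le_rfl, le_rfl⟩))
    exact fun h => hR h
  · rintro (rfl | rfl | h)
    · simpa using (isCIdeal (rect a b)).left ∅ y (by simp)
    · simpa using (isCIdeal (rect a b)).right x ∅ (by simp)
    · exact (rect a b).1.lower (Prod.mk_le_mk.2 h) (rect_le_iff.1 le_rfl)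

theorem bot_mem_left (C : ProdOpens L M) (b : M) : (⊥, b) ∈ (C : LowerSet (L × M)) := by
  simpa using (isCIdeal C).left ∅ b (by simp)

theorem bot_mem_right (C : ProdOpens L M) (a : L) : (a, ⊥) ∈ (C : LowerSet (L × M)) := by
  simpa using (isCIdeal C).right a ∅ (by simp)

theorem rect_eq_bot_iff {a : L} {b : M} : rect a b = ⊥ ↔ a = ⊥ ∨ b = ⊥ := by
  constructor
  · intro h
    have : (a, b) ∈ (rect ⊥ ⊥ : ProdOpens L M).1 := rect_le_iff.1 (h.le.trans bot_le)
    rcases mem_rect_iff.1 this with h | h | h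
    · exact Or.inl h
    · exact Or.inr h
    · exact Or.inl (le_bot_iff.1 h.1)
  · rintro (rfl | rfl)
    · exact le_bot_iff.1 (rect_le_iff.2 (bot_mem_left _ _))
    · exact le_bot_iff.1 (rect_le_iff.2 (bot_mem_right _ _))

theorem rect_iSup_right {ι : Sort*} (a : L) (b : ι → M) :
    rect a (⨆ i, b i) = ⨆ i, rect a (b i) := by
  simp only [rect_eq, map_iSup, inf_iSup_eq]

/-- The open `{(x, y, z) | (x, z) ∈ G}`. -/
def cylinder (G : ProdOpens L L) : TripleOpens L :=
  ⟨⟨{p | ∀ q ∈ (p.2 : LowerSet (L × L)), q.1 ≠ ⊥ → (p.1, q.2) ∈ (G : LowerSet (L × L))},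
    fun _ _ hqp hp r hr hr' => G.1.lower (Prod.mk_le_mk.2 ⟨hqp.1, le_rfl⟩) (hp r (hqp.2 hr) hr')⟩,
    { left := fun A C h q hq hq' => (isCIdeal G).left A q.2 fun a ha => h a ha q hq hq'
      right := fun a S h => by
        let H : ProdOpens L L :=
          ⟨⟨{q | q.1 ≠ ⊥ → (a, q.2) ∈ (G : LowerSet (L × L))}, fun p q hqp hp hq =>
            G.1.lower (Prod.mk_le_mk.2 ⟨le_rfl, hqp.2⟩)
              (hp fun h => hq (le_bot_iff.1 (h ▸ hqp.1)))⟩,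
          { left := fun A c hA hne => by
              obtain ⟨b, hb, hb'⟩ : ∃ b ∈ A, b ≠ ⊥ := by
                by_contra! hcon
                exact hne (sSup_eq_bot.2 hcon)
              exact hA b hb hb'
            right := fun b B hB hne => (isCIdeal G).right a B fun c hc => hB c hc hne }⟩
        have hS : sSup S ≤ H := sSup_le fun C hC q hq hq' => h C hC q hq hq'
        exact fun q hq hq' => hS hq hq' }⟩

/-- A nonzero `b` acts as a witness for the middle coordinate; over `b = ⊥` the box is empty and
imposes no condition. -/
theorem rect_rect_le_cylinder_iff {a b c : L} {G : ProdOpens L L} :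
    rect a (rect b c) ≤ cylinder G ↔ (b ≠ ⊥ → (a, c) ∈ (G : LowerSet (L × L))) := by
  rw [rect_le_iff]
  constructor
  · exact fun h hb => h (b, c) (rect_le_iff.1 le_rfl) hb
  · rintro h ⟨x, y⟩ hxy hx
    rcases mem_rect_iff.1 hxy with h' | rfl | h'
    · exact absurd h' hx
    · exact bot_mem_right _ _
    · exact G.1.lower (Prod.mk_le_mk.2 ⟨le_rfl, h'.2⟩)
        (h fun hb => hx (le_bot_iff.1 (hb ▸ h'.1)))

theorem pullback₁₃_rect (a c : L) : pullback₁₃ L (rect a c) = rect a (rect ⊤ c) := by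
  rw [pullback₁₃, lift_rect]
  exact (rect_eq a (rect ⊤ c)).symm

theorem pullback₁₂_rect (a b : L) : pullback₁₂ L (rect a b) = rect a (rect b ⊤) := by
  rw [pullback₁₂, lift_rect]
  exact (rect_eq a (rect b ⊤)).symm

theorem le_cylinder_of_rect {T : TripleOpens L} {C : TripleOpens L}
    (h : ∀ a b c, rect a (rect b c) ≤ T → rect a (rect b c) ≤ C) : T ≤ C := by
  rw [eq_iSup_rect T]
  refine iSup₂_le fun p hp => ?_
  rw [eq_iSup_rect p.2]
  simp only [rect_iSup_right]
  refine iSup₂_le fun q hq => h _ _ _ ?_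
  refine le_trans (rect_mono le_rfl (rect_le_iff.2 hq)) (rect_le_iff.2 hp)

theorem pullback₁₃_eq (G : ProdOpens L L) : pullback₁₃ L G = cylinder G := by
  refine le_antisymm ?_ (le_cylinder_of_rect fun a b c h => ?_)
  · rw [eq_iSup_rect G, map_iSup₂]
    refine iSup₂_le fun p hp => ?_
    rw [pullback₁₃_rect, ← eq_iSup_rect G]
    exact rect_rect_le_cylinder_iff.2 fun _ => hp
  · rcases eq_or_ne b ⊥ with rfl | hb
    · rw [rect_eq_bot_iff.2 (Or.inr (rect_eq_bot_iff.2 (Or.inl rfl)))]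
      exact bot_le
    · have := rect_rect_le_cylinder_iff.1 h hb
      calc rect a (rect b c) ≤ rect a (rect ⊤ c) := rect_mono le_rfl (rect_mono le_top le_rfl)
        _ = pullback₁₃ L (rect a c) := (pullback₁₃_rect a c).symm
        _ ≤ _ := OrderHomClass.mono _ (rect_le_iff.2 this)

/-- The content is that the infimum in `existsMiddle` is attained, i.e. that `pullback₁₃` respects
it. This is visible in the cylinder description, where each box with nonzero middle side only asks
for membership of its outer sides in the relation. -/
theorem existsMiddle_le_iff {T : TripleOpens L} {G : ProdOpens L L} :
    existsMiddle T ≤ G ↔ T ≤ pullback₁₃ L G := by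
  refine ⟨fun h => ?_, fun h => sInf_le h⟩
  refine le_trans ?_ (OrderHomClass.mono (pullback₁₃ L) h)
  rw [pullback₁₃_eq]
  refine le_cylinder_of_rect fun a b c hT => rect_rect_le_cylinder_iff.2 fun hb => ?_
  refine rect_le_iff.1 (le_sInf fun G' hG' => ?_)
  have h' : T ≤ pullback₁₃ L G' := hG'
  rw [pullback₁₃_eq] at h'
  exact rect_le_iff.2 (rect_rect_le_cylinder_iff.1 (hT.trans h') hb)

/-- Both relations are joins of rectangles, and two rectangles pull back and meet in a single box
whose middle side is `b ⊓ b'`. From here on triple products are no longer needed. -/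
theorem relComp_le_iff {F E G : ProdOpens L L} :
    relComp F E ≤ G ↔ ∀ a b b' c, (a, b) ∈ (E : LowerSet (L × L)) →
      (b', c) ∈ (F : LowerSet (L × L)) → b ⊓ b' ≠ ⊥ → (a, c) ∈ (G : LowerSet (L × L)) := by
  have key : ∀ a b b' c : L, pullback₁₂ L (rect a b) ⊓ pullback₂₃ L (rect b' c) =
      rect a (rect (b ⊓ b') c) := fun a b b' c => by
    rw [pullback₁₂_rect]
    change rect a (rect b ⊤) ⊓ rect ⊤ (rect b' c) = _
    rw [rect_inf_rect, rect_inf_rect, inf_top_eq, top_inf_eq]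
  rw [relComp, existsMiddle_le_iff, pullback₁₃_eq]
  constructor
  · intro h a b b' c hE hF hb
    refine rect_rect_le_cylinder_iff.1 (le_trans ?_ h) hb
    rw [← key]
    exact inf_le_inf (OrderHomClass.mono _ (rect_le_iff.2 hE))
      (OrderHomClass.mono _ (rect_le_iff.2 hF))
  · intro h
    rw [eq_iSup_rect E, eq_iSup_rect F]
    simp only [map_iSup, iSup_inf_eq, inf_iSup_eq, key]
    exact iSup₂_le fun p hp => iSup₂_le fun q hq =>
      rect_rect_le_cylinder_iff.2 fun hne => h _ _ _ _ hq hp hne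

theorem mem_relComp {F E : ProdOpens L L} {a b b' c : L} (hE : (a, b) ∈ (E : LowerSet (L × L)))
    (hF : (b', c) ∈ (F : LowerSet (L × L))) (h : b ⊓ b' ≠ ⊥) :
    (a, c) ∈ (relComp F E : LowerSet (L × L)) :=
  relComp_le_iff.1 le_rfl a b b' c hE hF h

theorem relComp_mono {F F' E E' : ProdOpens L L} (hF : F ≤ F') (hE : E ≤ E') :
    relComp F E ≤ relComp F' E' :=
  relComp_le_iff.2 fun _ _ _ _ h h' => mem_relComp (hE h) (hF h')

theorem swapPullback_rect (a b : L) : swapPullback L (rect a b) = rect b a := by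
  rw [swapPullback, lift_rect, inf_comm]
  exact (rect_eq b a).symm

theorem swapPullback_swapPullback (E : ProdOpens L L) :
    swapPullback L (swapPullback L E) = E := by
  have : (swapPullback L).comp (swapPullback L) = FrameHom.id _ := by
    refine prodOpens_hom_ext (fun a => ?_) (fun a => ?_)
    · change swapPullback L (swapPullback L (rect a ⊤)) = rect a ⊤
      rw [swapPullback_rect, swapPullback_rect]
    · change swapPullback L (swapPullback L (rect ⊤ a)) = rect ⊤ a
      rw [swapPullback_rect, swapPullback_rect]
  exact congrArg (fun f : FrameHom (ProdOpens L L) (ProdOpens L L) => f E) this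

theorem mem_swapPullback_iff {E : ProdOpens L L} {a b : L} :
    (a, b) ∈ (swapPullback L E : LowerSet (L × L)) ↔ (b, a) ∈ (E : LowerSet (L × L)) := by
  have h : ∀ (E : ProdOpens L L) (a b : L), (b, a) ∈ (E : LowerSet (L × L)) →
      (a, b) ∈ (swapPullback L E : LowerSet (L × L)) := fun E a b h => by
    rw [← rect_le_iff, ← swapPullback_rect]
    exact OrderHomClass.mono _ (rect_le_iff.2 h)
  refine ⟨fun h' => ?_, h E a b⟩
  rw [← swapPullback_swapPullback E]
  exact h _ _ _ h'

theorem diagPullback_apply (E : ProdOpens L L) :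
    diagPullback L E = ⨆ p ∈ (E : LowerSet (L × L)), p.1 ⊓ p.2 := rfl

theorem prodMap_rect {P Q : Type*} [Order.Frame P] [Order.Frame Q] (f : FrameHom L P)
    (g : FrameHom M Q) (a : L) (b : M) : prodMap f g (rect a b) = rect (f a) (g b) := by
  rw [prodMap, lift_rect]
  exact (rect_eq (f a) (g b)).symm

theorem prodMap_le_iff {P Q : Type*} [Order.Frame P] [Order.Frame Q] {f : FrameHom L P}
    {g : FrameHom M Q} {E : ProdOpens L M} {G : ProdOpens P Q} :
    prodMap f g E ≤ G ↔ ∀ a b, (a, b) ∈ (E : LowerSet (L × M)) →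
      (f a, g b) ∈ (G : LowerSet (P × Q)) := by
  constructor
  · intro h a b hab
    rw [← rect_le_iff, ← prodMap_rect]
    exact (OrderHomClass.mono _ (rect_le_iff.2 hab)).trans h
  · intro h
    rw [eq_iSup_rect E, map_iSup₂]
    refine iSup₂_le fun p hp => ?_
    rw [prodMap_rect]
    exact rect_le_iff.2 (h _ _ hp)

theorem mem_prodMap {P Q : Type*} [Order.Frame P] [Order.Frame Q] (f : FrameHom L P)
    (g : FrameHom M Q) {E : ProdOpens L M} {a : L} {b : M}
    (h : (a, b) ∈ (E : LowerSet (L × M))) :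
    (f a, g b) ∈ (prodMap f g E : LowerSet (P × Q)) :=
  prodMap_le_iff.1 le_rfl a b h

theorem diagPullback_prodMap (f : FrameHom L M) (E : ProdOpens L L) :
    diagPullback M (prodMap f f E) = f (diagPullback L E) := by
  have : (diagPullback M).comp (prodMap f f) = f.comp (diagPullback L) :=
    prodOpens_hom_ext
      (fun a => by simp [prodMap, diagPullback, lift_fst])
      (fun a => by simp [prodMap, diagPullback, lift_snd])
  exact congrArg (fun f : FrameHom (ProdOpens L L) M => f E) this

theorem swapPullback_prodMap (f : FrameHom L M) (E : ProdOpens L L) :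
    swapPullback M (prodMap f f E) = prodMap f f (swapPullback L E) := by
  have : (swapPullback M).comp (prodMap f f) = (prodMap f f).comp (swapPullback L) :=
    prodOpens_hom_ext
      (fun a => by simp [prodMap, swapPullback, lift_fst, lift_snd])
      (fun a => by simp [prodMap, swapPullback, lift_fst, lift_snd])
  exact congrArg (fun f : FrameHom (ProdOpens L L) (ProdOpens M M) => f E) this

/-- The residual of `G` with respect to precomposition. -/
def rightResidual (F G : ProdOpens L L) : ProdOpens L L :=
  ⟨⟨{p | ∀ b c, (b, c) ∈ (F : LowerSet (L × L)) → p.2 ⊓ b ≠ ⊥ →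
      (p.1, c) ∈ (G : LowerSet (L × L))}, fun p q hqp hp b c hF hne =>
        G.1.lower (Prod.mk_le_mk.2 ⟨hqp.1, le_rfl⟩)
          (hp b c hF fun h => hne (le_bot_iff.1 (h ▸ inf_le_inf_right b hqp.2)))⟩,
    { left := fun A y h b c hF hne => (isCIdeal G).left A c fun a ha => h a ha b c hF hne
      right := fun a B h b c hF hne => by
        by_contra hG
        refine hne ?_
        change sSup B ⊓ b = ⊥
        rw [sSup_inf_eq]
        refine iSup₂_eq_bot.2 fun b' hb' => ?_
        by_contra hne'
        exact hG (h b' hb' b c hF hne') }⟩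

theorem relComp_le_iff_le_rightResidual {F E G : ProdOpens L L} :
    relComp F E ≤ G ↔ E ≤ rightResidual F G :=
  relComp_le_iff.trans ⟨fun h p hp b c hF hne => h p.1 p.2 b c hp hF hne,
    fun h _ _ b' c hE hF hne => h hE b' c hF hne⟩

/-- The residual of `G` with respect to postcomposition. -/
def leftResidual (E G : ProdOpens L L) : ProdOpens L L :=
  ⟨⟨{p | ∀ a b, (a, b) ∈ (E : LowerSet (L × L)) → b ⊓ p.1 ≠ ⊥ →
      (a, p.2) ∈ (G : LowerSet (L × L))}, fun p q hqp hp a b hE hne =>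
        G.1.lower (Prod.mk_le_mk.2 ⟨le_rfl, hqp.2⟩)
          (hp a b hE fun h => hne (le_bot_iff.1 (h ▸ inf_le_inf_left b hqp.1)))⟩,
    { right := fun x B h a b hE hne => (isCIdeal G).right a B fun c hc => h c hc a b hE hne
      left := fun A y h a b hE hne => by
        by_contra hG
        refine hne ?_
        change b ⊓ sSup A = ⊥
        rw [inf_sSup_eq]
        refine iSup₂_eq_bot.2 fun b' hb' => ?_
        by_contra hne'
        exact hG (h b' hb' a b hE hne') }⟩

theorem relComp_le_iff_le_leftResidual {F E G : ProdOpens L L} :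
    relComp F E ≤ G ↔ F ≤ leftResidual E G :=
  relComp_le_iff.trans ⟨fun h p hp a b hE hne => h a b p.1 p.2 hE hp hne,
    fun h a b _ _ hE hF hne => h hF a b hE hne⟩

/-- Residuating in each argument in turn reduces the claim to images of single rectangles. If `f b`
and `f b'` overlap then `b ⊓ b' ≠ ⊥`, so the rectangles could already be composed before applying
`f`. -/
theorem relComp_prodMap_le (f : FrameHom L M) (F E : ProdOpens L L) :
    relComp (prodMap f f F) (prodMap f f E) ≤ prodMap f f (relComp F E) := by
  rw [relComp_le_iff_le_rightResidual, prodMap_le_iff]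
  intro a b hE
  rw [← rect_le_iff, ← relComp_le_iff_le_rightResidual, relComp_le_iff_le_leftResidual,
    prodMap_le_iff]
  intro b' c hF
  rw [← rect_le_iff, ← relComp_le_iff_le_leftResidual, relComp_le_iff]
  intro x y y' z h h' hne
  rcases mem_rect_iff.1 h with rfl | rfl | h
  · exact bot_mem_left _ _
  · simp at hne
  rcases mem_rect_iff.1 h' with rfl | rfl | h'
  · simp at hne
  · exact bot_mem_right _ _
  refine (prodMap f f (relComp F E)).1.lower (Prod.mk_le_mk.2 ⟨h.1, h'.2⟩)
    (mem_prodMap f f (mem_relComp hE hF fun hb => hne ?_))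
  refine le_bot_iff.1 ((inf_le_inf h.2 h'.1).trans ?_)
  rw [← map_inf, hb, map_bot]

end Relations

/-! ### Uniformities -/

section Uniformities

variable {L M N : Type*} [Order.Frame L] [Order.Frame M] [Order.Frame N]

/-- This is how reflexivity is used: any open is cut into `E`-small pieces, each having its square
in `E`. -/
theorem diag_cover {E : ProdOpens L L} (hE : diagPullback L E = ⊤) (a : L) :
    a = ⨆ p ∈ (E : LowerSet (L × L)), a ⊓ (p.1 ⊓ p.2) := by
  rw [← inf_iSup₂_eq, ← diagPullback_apply, hE, inf_top_eq]

/-- The largest open relation which relates no part of `a` to anything outside `b`. -/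
def nearBound (a b : L) : ProdOpens L L :=
  ⟨⟨{p | a ⊓ p.1 ≠ ⊥ → p.2 ≤ b}, fun p q hqp hp hne =>
      hqp.2.trans (hp fun h => hne (le_bot_iff.1 (h ▸ inf_le_inf_left a hqp.1)))⟩,
    { left := fun A y h hne => by
        by_contra hy
        refine hne ?_
        change a ⊓ sSup A = ⊥
        rw [inf_sSup_eq]
        refine iSup₂_eq_bot.2 fun x hx => ?_
        by_contra hne'
        exact hy (h x hx hne')
      right := fun x B h hne => sSup_le fun y hy => h y hy hne }⟩

theorem le_nearBound_iff {E : ProdOpens L L} {a b : L} :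
    E ≤ nearBound a b ↔
      ∀ y z, (y, z) ∈ (E : LowerSet (L × L)) → a ⊓ y ≠ ⊥ → z ≤ b :=
  ⟨fun h _ _ hyz => h hyz, fun h p hp => h p.1 p.2 hp⟩

theorem le_of_le_nearBound {E : ProdOpens L L} (hE : diagPullback L E = ⊤) {a b : L}
    (h : E ≤ nearBound a b) : a ≤ b := by
  rw [diag_cover hE a]
  refine iSup₂_le fun p hp => ?_
  by_cases hne : a ⊓ p.1 = ⊥
  · rw [← inf_assoc, hne, bot_inf_eq]
    exact bot_le
  · exact inf_le_right.trans (inf_le_right.trans (h hp hne))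

/-- The right side only bounds what is near `a`; reflexivity supplies the missing inequality `a ≤ b`
for the first coordinate. -/
theorem relComp_rect_le_iff {E : ProdOpens L L} (hE : diagPullback L E = ⊤) {a b : L} :
    relComp E (rect a a) ≤ rect b b ↔ E ≤ nearBound a b := by
  constructor
  · intro h p hp hne
    by_cases hz : p.2 = ⊥
    · exact hz ▸ bot_le
    have ha : a ≠ ⊥ := fun ha => hne (by rw [ha, bot_inf_eq])
    have := relComp_le_iff.1 h a a p.1 p.2 (rect_le_iff.1 le_rfl) hp hne
    exact (((mem_rect_iff.1 this).resolve_left ha).resolve_left hz).2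
  · intro h
    refine relComp_le_iff.2 fun x y y' z hxy hyz hne => ?_
    rcases mem_rect_iff.1 hxy with rfl | rfl | hxy
    · exact bot_mem_left _ _
    · simp at hne
    · refine mem_rect_iff.2 (Or.inr (Or.inr ⟨hxy.1.trans (le_of_le_nearBound hE h), ?_⟩))
      exact le_nearBound_iff.1 h _ _ hyz
        fun hb => hne (le_bot_iff.1 (hb ▸ inf_le_inf_right y' hxy.2))

/-! ### The uniformly below relation and the core -/

namespace Uniformity

/-- `nearBound a b` is the largest possible witness, so the existential quantifier over entourages
collapses to one membership. -/
theorem uniformlyBelow_iff {𝓔 : Uniformity L} {a b : L} :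
    𝓔.UniformlyBelow a b ↔ nearBound a b ∈ 𝓔.entourages := by
  constructor
  · rintro ⟨E, hE, h⟩
    exact Order.PFilter.mem_of_le ((relComp_rect_le_iff (𝓔.diag_eq_top E hE)).1 h) hE
  · exact fun h => ⟨_, h, (relComp_rect_le_iff (𝓔.diag_eq_top _ h)).2 le_rfl⟩

theorem UniformlyBelow.le {𝓔 : Uniformity L} {a b : L} (h : 𝓔.UniformlyBelow a b) : a ≤ b :=
  le_of_le_nearBound (𝓔.diag_eq_top _ (uniformlyBelow_iff.1 h)) le_rfl

theorem UniformlyBelow.mono {𝓔 : Uniformity L} {a a' b b' : L} (h : 𝓔.UniformlyBelow a b)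
    (ha : a' ≤ a) (hb : b ≤ b') : 𝓔.UniformlyBelow a' b' :=
  uniformlyBelow_iff.2 <| Order.PFilter.mem_of_le
    (le_nearBound_iff.2 fun _ y hy hne => (le_nearBound_iff.1 le_rfl _ y hy
      fun h => hne (le_bot_iff.1 (h ▸ inf_le_inf_right _ ha))).trans hb)
    (uniformlyBelow_iff.1 h)

theorem UniformlyBelow.inf {𝓔 : Uniformity L} {a a' b b' : L} (h : 𝓔.UniformlyBelow a b)
    (h' : 𝓔.UniformlyBelow a' b') : 𝓔.UniformlyBelow (a ⊓ a') (b ⊓ b') := by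
  rw [uniformlyBelow_iff] at *
  refine Order.PFilter.mem_of_le ?_ (Order.PFilter.inf_mem h h')
  refine le_nearBound_iff.2 fun y z hyz hne => le_inf ?_ ?_
  · exact le_nearBound_iff.1 le_rfl _ z hyz.1
      fun h => hne (le_bot_iff.1 (h ▸ inf_le_inf_right _ inf_le_left))
  · exact le_nearBound_iff.1 le_rfl _ z hyz.2
      fun h => hne (le_bot_iff.1 (h ▸ inf_le_inf_right _ inf_le_right))

/-- The open of all points which are `F`-close to a point of `a`. -/
def star (F : ProdOpens L L) (a : L) : L :=
  sSup {z | ∃ y, (y, z) ∈ (F : LowerSet (L × L)) ∧ a ⊓ y ≠ ⊥}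

theorem le_nearBound_star (F : ProdOpens L L) (a : L) : F ≤ nearBound a (star F a) :=
  le_nearBound_iff.2 fun y _ hyz hne => le_sSup ⟨y, hyz, hne⟩

theorem uniformlyBelow_star {𝓔 : Uniformity L} {F : ProdOpens L L} (hF : F ∈ 𝓔.entourages)
    (a : L) : 𝓔.UniformlyBelow a (star F a) :=
  uniformlyBelow_iff.2 (Order.PFilter.mem_of_le (le_nearBound_star F a) hF)

theorem exists_inf_ne_bot_of_star {F : ProdOpens L L} {a y : L} (h : star F a ⊓ y ≠ ⊥) :
    ∃ x z, (x, z) ∈ (F : LowerSet (L × L)) ∧ a ⊓ x ≠ ⊥ ∧ z ⊓ y ≠ ⊥ := by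
  by_contra! hcon
  refine h ?_
  rw [star, sSup_inf_eq]
  exact iSup₂_eq_bot.2 fun z ⟨x, hxz, hne⟩ => hcon x z hxz hne

/-- Split the witnessing entourage as `F ∘ F`: one `F`-step from `a` reaches `star F a`, and a
second step still stays in `b`. -/
theorem UniformlyBelow.interpolate {𝓔 : Uniformity L} {a b : L} (h : 𝓔.UniformlyBelow a b) :
    ∃ c, 𝓔.UniformlyBelow a c ∧ 𝓔.UniformlyBelow c b := by
  obtain ⟨F, hF, hFE⟩ := 𝓔.exists_comp_le _ (uniformlyBelow_iff.1 h)
  refine ⟨star F a, uniformlyBelow_star hF a, uniformlyBelow_iff.2 ?_⟩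
  refine Order.PFilter.mem_of_le (le_nearBound_iff.2 fun y z hyz hne => ?_) hF
  obtain ⟨x, y', hxy', hax, hy⟩ := exists_inf_ne_bot_of_star hne
  exact hFE (mem_relComp hxy' hyz hy) hax

theorem le_core {𝓔 : Uniformity L} {a b : L} (h : 𝓔.UniformlyBelow a b) : a ≤ 𝓔.core b :=
  le_sSup h

theorem core_le (𝓔 : Uniformity L) (b : L) : 𝓔.core b ≤ b :=
  sSup_le fun _ h => UniformlyBelow.le h

theorem isConucleus_core (𝓔 : Uniformity L) : IsConucleus 𝓔.core where
  monotone _ _ hab := sSup_le fun _ h => le_core (UniformlyBelow.mono h le_rfl hab)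
  le_self := 𝓔.core_le
  idempotent b := le_antisymm (𝓔.core_le _) <| sSup_le fun a h => by
    obtain ⟨c, hac, hcb⟩ := UniformlyBelow.interpolate h
    exact le_core (hac.mono le_rfl (le_core hcb))
  map_top := by
    obtain ⟨E, hE⟩ := 𝓔.entourages.nonempty
    exact top_le_iff.1 (le_core ((uniformlyBelow_star hE ⊤).mono le_rfl le_top))
  map_inf a b := by
    refine le_antisymm (le_inf ?_ ?_) ?_
    · exact sSup_le fun _ h => le_core (UniformlyBelow.mono h le_rfl inf_le_left)
    · exact sSup_le fun _ h => le_core (UniformlyBelow.mono h le_rfl inf_le_right)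
    · rw [core, core, sSup_inf_sSup]
      exact iSup₂_le fun p hp => le_core (UniformlyBelow.inf hp.1 hp.2)

end Uniformity

theorem IsConucleus.isSubframe_fixedPoints {r : L → L} (hr : IsConucleus r) :
    IsSubframe (Function.fixedPoints r) where
  top_mem := hr.map_top
  inf_mem _ ha _ hb := (hr.map_inf _ _).trans (congrArg₂ _ ha hb)
  sSup_mem _ hA := le_antisymm (hr.le_self _) <| sSup_le fun _ ha =>
    (hA ha).symm.le.trans (hr.monotone (le_sSup ha))

namespace Uniformity

variable (L) in
theorem setOf_eq_fixedPoints (𝓔 : Uniformity L) :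
    {b : L | b = sSup {a | 𝓔.UniformlyBelow a b}} = Function.fixedPoints 𝓔.core :=
  Set.ext fun _ => eq_comm

theorem swap_mem {𝓔 : Uniformity L} {E : ProdOpens L L} (hE : E ∈ 𝓔.entourages) :
    swapPullback L E ∈ 𝓔.entourages := by
  obtain ⟨E', hE', rfl⟩ := 𝓔.exists_swap E hE
  rwa [swapPullback_swapPullback]

theorem exists_symm_comp₃ {𝓔 : Uniformity L} {E : ProdOpens L L} (hE : E ∈ 𝓔.entourages) :
    ∃ F ∈ 𝓔.entourages, swapPullback L F = F ∧ relComp F (relComp F F) ≤ E := by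
  obtain ⟨H, hH, hHE⟩ := 𝓔.exists_comp_le E hE
  obtain ⟨K, hK, hKH⟩ := 𝓔.exists_comp_le H hH
  -- The inner composite is below `K ∘ K ≤ H`; meeting with `H` keeps the third factor below `H`, so
  -- `H ∘ H ≤ E` finishes. Meeting with the swap gives symmetry.
  refine ⟨(K ⊓ H) ⊓ swapPullback L (K ⊓ H), ?_, ?_, ?_⟩
  · exact Order.PFilter.inf_mem (Order.PFilter.inf_mem hK hH)
      (swap_mem (Order.PFilter.inf_mem hK hH))
  · rw [map_inf, swapPullback_swapPullback, inf_comm]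
  · refine (relComp_mono (inf_le_left.trans inf_le_right) (LE.le.trans ?_ hKH)).trans hHE
    exact relComp_mono (inf_le_left.trans inf_le_left) (inf_le_left.trans inf_le_left)

/-! ### Uniformities from subbases and initial uniformities -/

/-- The filter generated by a set of open relations. -/
inductive Generated (S : Set (ProdOpens L L)) : ProdOpens L L → Prop
  | basic {E} : E ∈ S → Generated S E
  | top : Generated S ⊤
  | inf {E F} : Generated S E → Generated S F → Generated S (E ⊓ F)
  | mono {E F} : E ≤ F → Generated S E → Generated S F

/-- The uniformity with a given subbase. -/
def generate (S : Set (ProdOpens L L)) (hdiag : ∀ E ∈ S, diagPullback L E = ⊤)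
    (hswap : ∀ E ∈ S, swapPullback L E ∈ S) (hcomp : ∀ E ∈ S, ∃ F ∈ S, relComp F F ≤ E) :
    Uniformity L where
  entourages := Order.IsPFilter.toPFilter (F := {E | Generated S E}) <| .of_def
    ⟨⊤, .top⟩ (fun E hE F hF => ⟨E ⊓ F, .inf hE hF, inf_le_left, inf_le_right⟩) .mono
  diag_eq_top E hE := by
    change Generated S E at hE
    induction hE with
    | basic h => exact hdiag _ h
    | top => exact map_top _
    | inf _ _ h h' => rw [map_inf, h, h', inf_top_eq]
    | mono hle _ h => exact top_le_iff.1 (h.symm.le.trans (OrderHomClass.mono _ hle))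
  exists_swap E hE := by
    refine ⟨swapPullback L E, ?_, (swapPullback_swapPullback E).symm⟩
    change Generated S E at hE
    change Generated S _
    induction hE with
    | basic h => exact .basic (hswap _ h)
    | top => exact (map_top (swapPullback L)).symm ▸ .top
    | inf _ _ h h' =>
      rw [map_inf]
      exact .inf h h'
    | mono hle _ h => exact .mono (OrderHomClass.mono (swapPullback L) hle) h
  exists_comp_le E hE := by
    change Generated S E at hE
    change ∃ F, Generated S F ∧ _
    induction hE with
    | basic h =>
      obtain ⟨F, hF, h⟩ := hcomp _ h
      exact ⟨F, .basic hF, h⟩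
    | top => exact ⟨⊤, .top, le_top⟩
    | inf _ _ h h' =>
      obtain ⟨F, hF, h⟩ := h
      obtain ⟨F', hF', h'⟩ := h'
      exact ⟨F ⊓ F', .inf hF hF', le_inf ((relComp_mono inf_le_left inf_le_left).trans h)
        ((relComp_mono inf_le_right inf_le_right).trans h')⟩
    | mono hle _ h =>
      obtain ⟨F, hF, h⟩ := h
      exact ⟨F, hF, h.trans hle⟩

theorem prodMap_mem_of_generated {S : Set (ProdOpens L L)} {𝓖 : Uniformity M} {f : FrameHom L M}
    (h : ∀ E ∈ S, prodMap f f E ∈ 𝓖.entourages) {E : ProdOpens L L} (hE : Generated S E) :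
    prodMap f f E ∈ 𝓖.entourages := by
  induction hE with
  | basic hE => exact h _ hE
  | top => exact (map_top (prodMap f f)).symm ▸ Order.PFilter.top_mem
  | inf _ _ h h' =>
    rw [map_inf]
    exact Order.PFilter.inf_mem h h'
  | mono hle _ h => exact Order.PFilter.mem_of_le (OrderHomClass.mono _ hle) h

theorem exists_comp_prodMap_le {𝓕 : Uniformity L} (f : FrameHom L M) {F : ProdOpens L L}
    (hF : F ∈ 𝓕.entourages) :
    ∃ H ∈ 𝓕.entourages, relComp (prodMap f f H) (prodMap f f H) ≤ prodMap f f F := by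
  obtain ⟨H, hH, hHF⟩ := 𝓕.exists_comp_le F hF
  exact ⟨H, hH, (relComp_prodMap_le f H H).trans (OrderHomClass.mono _ hHF)⟩

/-- The coarsest uniformity making a family of locale maps uniform. -/
def initial {ι : Type*} {A : ι → Type*} [∀ i, Order.Frame (A i)] (𝓕 : ∀ i, Uniformity (A i))
    (f : ∀ i, FrameHom (A i) M) : Uniformity M :=
  generate {E | ∃ i, ∃ F ∈ (𝓕 i).entourages, prodMap (f i) (f i) F = E}
    (by
      rintro _ ⟨i, F, hF, rfl⟩
      rw [diagPullback_prodMap, (𝓕 i).diag_eq_top F hF, map_top])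
    (by
      rintro _ ⟨i, F, hF, rfl⟩
      exact ⟨i, _, swap_mem hF, (swapPullback_prodMap _ _).symm⟩)
    (by
      rintro _ ⟨i, F, hF, rfl⟩
      obtain ⟨H, hH, h⟩ := exists_comp_prodMap_le (f i) hF
      exact ⟨_, ⟨i, H, hH, rfl⟩, h⟩)

theorem mem_initial {ι : Type*} {A : ι → Type*} [∀ i, Order.Frame (A i)]
    {𝓕 : ∀ i, Uniformity (A i)} {f : ∀ i, FrameHom (A i) M} (i : ι) {F : ProdOpens (A i) (A i)}
    (hF : F ∈ (𝓕 i).entourages) : prodMap (f i) (f i) F ∈ (initial 𝓕 f).entourages :=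
  Generated.basic ⟨i, F, hF, rfl⟩

theorem prodMap_mem_of_mem_initial {ι : Type*} {A : ι → Type*} [∀ i, Order.Frame (A i)]
    {𝓕 : ∀ i, Uniformity (A i)} {f : ∀ i, FrameHom (A i) M} {k : FrameHom M N} {𝓖 : Uniformity N}
    (h : ∀ i, ∀ F ∈ (𝓕 i).entourages, prodMap (k.comp (f i)) (k.comp (f i)) F ∈ 𝓖.entourages)
    {E : ProdOpens M M} (hE : E ∈ (initial 𝓕 f).entourages) : prodMap k k E ∈ 𝓖.entourages := by
  refine prodMap_mem_of_generated ?_ hE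
  rintro _ ⟨i, F, hF, rfl⟩
  have := h i F hF
  rwa [prodMap_comp] at this

end Uniformity

/-! ### The quotient onto the frame of fixed points of the core -/

/-- The largest open relation which is sent below `E`. -/
def comapRel (i : FrameHom M L) (E : ProdOpens L L) : ProdOpens M M :=
  ⟨⟨{p | (i p.1, i p.2) ∈ (E : LowerSet (L × L))}, fun _ _ hqp hp =>
      E.1.lower (Prod.mk_le_mk.2 ⟨OrderHomClass.mono i hqp.1, OrderHomClass.mono i hqp.2⟩) hp⟩,
    { left := fun A b h => by
        change (i (sSup A), i b) ∈ (E : LowerSet (L × L))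
        rw [map_sSup]
        refine (isCIdeal E).left _ _ ?_
        rintro _ ⟨a, ha, rfl⟩
        exact h a ha
      right := fun a B h => by
        change (i a, i (sSup B)) ∈ (E : LowerSet (L × L))
        rw [map_sSup]
        refine (isCIdeal E).right _ _ ?_
        rintro _ ⟨b, hb, rfl⟩
        exact h b hb }⟩

theorem mem_comapRel {i : FrameHom M L} {E : ProdOpens L L} {a b : M} :
    (a, b) ∈ (comapRel i E : LowerSet (M × M)) ↔ (i a, i b) ∈ (E : LowerSet (L × L)) := Iff.rfl

theorem iSup_mem_left {C : ProdOpens L M} {ι : Sort*} {f : ι → L} {b : M}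
    (h : ∀ i, (f i, b) ∈ (C : LowerSet (L × M))) : (⨆ i, f i, b) ∈ (C : LowerSet (L × M)) :=
  (isCIdeal C).left _ _ (Set.forall_mem_range.2 h)

theorem iSup_mem_right {C : ProdOpens L M} {ι : Sort*} {a : L} {f : ι → M}
    (h : ∀ i, (a, f i) ∈ (C : LowerSet (L × M))) : (a, ⨆ i, f i) ∈ (C : LowerSet (L × M)) :=
  (isCIdeal C).right _ _ (Set.forall_mem_range.2 h)

/-- If `i` is injective, then up to threefold composition a reflexive relation `K` contains every
relation whose image under `i` is contained in that of `K`. -/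
theorem comapRel_prodMap_le {i : FrameHom M L} (hi : Function.Injective i) {K : ProdOpens M M}
    (hdiag : diagPullback M K = ⊤) :
    comapRel i (prodMap i i K) ≤ relComp K (relComp K K) := by
  rintro ⟨a, b⟩ hab
  have hab' : (i a, i b) ∈ (prodMap i i K : LowerSet (L × L)) := hab
  change (a, b) ∈ (relComp K (relComp K K) : LowerSet (M × M))
  -- It suffices to treat `K`-small pieces `a'` of `a` and `b'` of `b`.
  rw [diag_cover hdiag a]
  refine iSup_mem_left fun p => iSup_mem_left fun hp => ?_
  rw [diag_cover hdiag b]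
  refine iSup_mem_right fun q => iSup_mem_right fun hq => ?_
  set a' := a ⊓ (p.1 ⊓ p.2)
  set b' := b ⊓ (q.1 ⊓ q.2)
  by_cases ha' : a' = ⊥
  · simp only [ha']
    exact bot_mem_left _ _
  by_cases hb' : b' = ⊥
  · simp only [hb']
    exact bot_mem_right _ _
  have hle : rect (i a') (i b') ≤ prodMap i i K :=
    (rect_mono (OrderHomClass.mono i inf_le_left) (OrderHomClass.mono i inf_le_left)).trans
      (rect_le_iff.2 hab')
  have hne : rect (i a') (i b') ≠ ⊥ := fun h => by
    rcases rect_eq_bot_iff.1 h with h | h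
    · exact ha' ((eq_bot_iff_of_injective hi).1 h)
    · exact hb' ((eq_bot_iff_of_injective hi).1 h)
  -- A nonzero rectangle below the image of `K` must meet the image of some rectangle of `K`, and
  -- injectivity of `i` reflects the overlaps back to `M`. The three steps of the composite are then
  -- `a'` to itself, `x` to `y`, and `b'` to itself.
  obtain ⟨x, y, hxy, hx, hy⟩ : ∃ x y, (x, y) ∈ (K : LowerSet (M × M)) ∧
      a' ⊓ x ≠ ⊥ ∧ y ⊓ b' ≠ ⊥ := by
    by_contra! hcon
    refine hne ?_
    rw [← inf_eq_left.2 hle, eq_iSup_rect K, map_iSup₂, inf_iSup₂_eq]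
    refine iSup₂_eq_bot.2 fun r hr => ?_
    rw [prodMap_rect, rect_inf_rect, rect_eq_bot_iff, ← map_inf, ← map_inf,
      eq_bot_iff_of_injective hi, eq_bot_iff_of_injective hi, or_iff_not_imp_left, inf_comm b']
    exact hcon r.1 r.2 hr
  have haa : (a', a') ∈ (K : LowerSet (M × M)) :=
    K.1.lower (Prod.mk_le_mk.2 ⟨inf_le_right.trans inf_le_left, inf_le_right.trans inf_le_right⟩) hp
  have hbb : (b', b') ∈ (K : LowerSet (M × M)) :=
    K.1.lower (Prod.mk_le_mk.2 ⟨inf_le_right.trans inf_le_left, inf_le_right.trans inf_le_right⟩) hq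
  exact mem_relComp (mem_relComp haa hxy hx) hbb hy

/-- An embedding of frames identifying its domain with the frame of opens which are fixed by
the core of a uniformity. -/
structure IsCoreEmbedding (𝓔 : Uniformity L) (i : FrameHom M L) : Prop where
  injective : Function.Injective i
  range_eq : Set.range i = Function.fixedPoints 𝓔.core

/-! ### The uniformity on the fixed opens: admissibility and finality -/

namespace IsCoreEmbedding

variable {𝓔 : Uniformity L} {i : FrameHom M L}

theorem core_mem_range (hi : IsCoreEmbedding 𝓔 i) (a : L) : 𝓔.core a ∈ Set.range i := by
  rw [hi.range_eq]
  exact 𝓔.isConucleus_core.idempotent a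

theorem core_apply (hi : IsCoreEmbedding 𝓔 i) (a : M) : 𝓔.core (i a) = i a := by
  have : i a ∈ Function.fixedPoints 𝓔.core := hi.range_eq ▸ Set.mem_range_self a
  exact this

/-- Travel from the star of `y` back to `y` by symmetry, across to `z`, and out to the star of `z`:
three `F`-steps. -/
theorem star_mem {E F : ProdOpens L L} (hF : swapPullback L F = F)
    (hFE : relComp F (relComp F F) ≤ E) {y z : L} (h : (y, z) ∈ (F : LowerSet (L × L))) :
    (Uniformity.star F y, Uniformity.star F z) ∈ (E : LowerSet (L × L)) := by
  refine (isCIdeal E).left _ _ ?_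
  rintro w ⟨y', hw, hy⟩
  refine (isCIdeal E).right _ _ ?_
  rintro v ⟨z', hv, hz⟩
  rw [← hF, mem_swapPullback_iff] at hw
  exact hFE (mem_relComp (mem_relComp hw h (by rwa [inf_comm])) hv hz)

/-- A rectangle of a small `F` need not have fixed sides, but each side is uniformly below its star,
hence below the core of the star, which is fixed. The enlarged rectangle still fits in `E`. -/
theorem prodMap_comapRel_mem (hi : IsCoreEmbedding 𝓔 i) {E : ProdOpens L L}
    (hE : E ∈ 𝓔.entourages) : prodMap i i (comapRel i E) ∈ 𝓔.entourages := by
  obtain ⟨F, hF, hswap, hFE⟩ := Uniformity.exists_symm_comp₃ hE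
  refine Order.PFilter.mem_of_le ?_ hF
  rintro ⟨y, z⟩ hyz
  obtain ⟨a, ha⟩ := hi.core_mem_range (Uniformity.star F y)
  obtain ⟨b, hb⟩ := hi.core_mem_range (Uniformity.star F z)
  have hab : (a, b) ∈ (comapRel i E : LowerSet (M × M)) := by
    rw [mem_comapRel, ha, hb]
    exact E.1.lower (Prod.mk_le_mk.2 ⟨𝓔.core_le _, 𝓔.core_le _⟩) (star_mem hswap hFE hyz)
  refine (prodMap i i (comapRel i E)).1.lower (Prod.mk_le_mk.2 ⟨?_, ?_⟩) (mem_prodMap i i hab)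
  · exact ha ▸ Uniformity.le_core (Uniformity.uniformlyBelow_star hF y)
  · exact hb ▸ Uniformity.le_core (Uniformity.uniformlyBelow_star hF z)

/-- The uniformity on the frame of fixed points of the core. -/
def uniformity (hi : IsCoreEmbedding 𝓔 i) : Uniformity M :=
  Uniformity.generate {G | ∃ E ∈ 𝓔.entourages, comapRel i E = G}
    (by
      rintro _ ⟨E, hE, rfl⟩
      refine hi.injective ?_
      rw [← diagPullback_prodMap, map_top]
      exact 𝓔.diag_eq_top _ (hi.prodMap_comapRel_mem hE))
    (by
      rintro _ ⟨E, hE, rfl⟩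
      refine ⟨_, Uniformity.swap_mem hE, ?_⟩
      ext ⟨a, b⟩
      change (i a, i b) ∈ (swapPullback L E : LowerSet (L × L)) ↔
        (a, b) ∈ (swapPullback M (comapRel i E) : LowerSet (M × M))
      rw [mem_swapPullback_iff, mem_swapPullback_iff, mem_comapRel])
    (by
      rintro _ ⟨E, hE, rfl⟩
      obtain ⟨F, hF, hFE⟩ := 𝓔.exists_comp_le E hE
      refine ⟨_, ⟨F, hF, rfl⟩, relComp_le_iff.2 fun a b b' c h h' hne => ?_⟩
      refine hFE (mem_relComp h h' ?_)
      rwa [← map_inf, Ne, eq_bot_iff_of_injective hi.injective])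

theorem comapRel_mem (hi : IsCoreEmbedding 𝓔 i) {E : ProdOpens L L} (hE : E ∈ 𝓔.entourages) :
    comapRel i E ∈ hi.uniformity.entourages := Uniformity.Generated.basic ⟨E, hE, rfl⟩

theorem prodMap_mem (hi : IsCoreEmbedding 𝓔 i) {G : ProdOpens M M}
    (hG : G ∈ hi.uniformity.entourages) : prodMap i i G ∈ 𝓔.entourages := by
  refine Uniformity.prodMap_mem_of_generated ?_ hG
  rintro _ ⟨E, hE, rfl⟩
  exact hi.prodMap_comapRel_mem hE

theorem isAdmissible (hi : IsCoreEmbedding 𝓔 i) : hi.uniformity.IsAdmissible := by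
  intro b
  refine le_antisymm ?_ (hi.uniformity.core_le b)
  rw [← le_iff_of_injective hi.injective, map_sSup, ← hi.core_apply]
  refine sSup_le fun a hab => ?_
  obtain ⟨c, hac, hcb⟩ := Uniformity.UniformlyBelow.interpolate hab
  -- The interpolant `c` need not be fixed, so its core replaces it: this still lies above `a`, and
  -- lying below `c` it inherits the bound by `i b`.
  obtain ⟨d, hd⟩ := hi.core_mem_range c
  refine (Uniformity.le_core hac).trans (hd ▸ le_sSup ⟨d, ?_, rfl⟩)
  refine Uniformity.uniformlyBelow_iff.2 (Order.PFilter.mem_of_le ?_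
    (hi.comapRel_mem (Uniformity.uniformlyBelow_iff.1 hcb)))
  refine le_nearBound_iff.2 fun y z hyz hne => ?_
  rw [← le_iff_of_injective hi.injective]
  refine le_nearBound_iff.1 le_rfl _ _ (mem_comapRel.1 hyz) fun h => hne ?_
  rw [← eq_bot_iff_of_injective hi.injective, map_inf, hd]
  exact le_bot_iff.1 ((inf_le_inf_right _ (𝓔.core_le c)).trans h.le)

/-- The uniformity on the fixed points of the core is final. -/
theorem prodMap_mem_uniformity (hi : IsCoreEmbedding 𝓔 i) {𝓖 : Uniformity N} {h : FrameHom N M}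
    (hg : ∀ G ∈ 𝓖.entourages, prodMap (i.comp h) (i.comp h) G ∈ 𝓔.entourages) :
    ∀ G ∈ 𝓖.entourages, prodMap h h G ∈ hi.uniformity.entourages := by
  intro G hG
  -- Restricting an image along `i` costs a threefold composite, so a threefold root of `G` is
  -- chosen in advance.
  obtain ⟨H, hH, -, hHG⟩ := Uniformity.exists_symm_comp₃ hG
  have hE := hg H hH
  rw [prodMap_comp] at hE
  change prodMap i i (prodMap h h H) ∈ _ at hE
  refine Order.PFilter.mem_of_le ((comapRel_prodMap_le hi.injective ?_).trans ?_)
    (hi.comapRel_mem hE)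
  · rw [diagPullback_prodMap, 𝓖.diag_eq_top H hH, map_top]
  · exact ((relComp_mono le_rfl (relComp_prodMap_le h H H)).trans
      (relComp_prodMap_le h _ _)).trans (OrderHomClass.mono _ hHG)

end IsCoreEmbedding

/-- Uniform maps preserve the uniformly below relation. -/
theorem Uniformity.UniformlyBelow.map {𝓔 : Uniformity L} {𝓕 : Uniformity M} {f : FrameHom M L}
    (hf : ∀ F ∈ 𝓕.entourages, prodMap f f F ∈ 𝓔.entourages) {a b : M}
    (h : 𝓕.UniformlyBelow a b) : 𝓔.UniformlyBelow (f a) (f b) := by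
  refine uniformlyBelow_iff.2 (Order.PFilter.mem_of_le ?_ (hf _ (uniformlyBelow_iff.1 h)))
  refine prodMap_le_iff.2 fun y z hyz hne => OrderHomClass.mono f ?_
  refine le_nearBound_iff.1 le_rfl _ _ hyz fun h => hne ?_
  rw [← map_inf, h, map_bot]

/-- `f b` is the join of the `f a` with `a` uniformly below `b`, and each such `f a` is uniformly
below `f b`. -/
theorem Uniformity.IsAdmissible.apply_mem_fixedPoints {𝓔 : Uniformity L} {𝓕 : Uniformity M}
    (h𝓕 : 𝓕.IsAdmissible) {f : FrameHom M L}
    (hf : ∀ F ∈ 𝓕.entourages, prodMap f f F ∈ 𝓔.entourages) (b : M) :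
    f b ∈ Function.fixedPoints 𝓔.core := by
  refine le_antisymm (𝓔.core_le _) ?_
  conv_lhs => rw [h𝓕 b, map_sSup]
  rw [sSup_image]
  exact iSup₂_le fun a ha => le_core (UniformlyBelow.map hf ha)

end Uniformities

/-! ### Limits and colimits of frames -/

section Pi

variable {ι : Type*} {A : ι → Type*} [∀ i, Order.Frame (A i)] {γ : Type*} [Order.Frame γ]

/-- The projections of a product of frames. -/
def evalHom (i : ι) : FrameHom (∀ i, A i) (A i) where
  toFun x := x i
  map_inf' _ _ := rfl
  map_top' := rfl
  map_sSup' s := by rw [sSup_apply, sSup_image, iSup_subtype]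

/-- The homomorphism into a product of frames given by a family of homomorphisms. -/
def piHom (f : ∀ i, FrameHom γ (A i)) : FrameHom γ (∀ i, A i) where
  toFun c i := f i c
  map_inf' _ _ := funext fun _ => map_inf _ _ _
  map_top' := funext fun _ => map_top _
  map_sSup' s := funext fun i => by
    rw [map_sSup, sSup_image, sSup_apply, iSup_subtype, iSup_image]

end Pi

section Generated

variable {G : Type u} {β : Type v} [Order.Frame β] (φ : G → β)

/-- The join of a set of finite meets of generators. -/
def joinOfMeets (T : Set (Finset G)) : β := ⨆ s ∈ T, s.inf φ

/-- By distributivity, a meet of two such joins is the join of the meets over unions `s ∪ t`, so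
joins of finite meets already form a subframe. -/
theorem isSubframe_range_joinOfMeets : IsSubframe (Set.range (joinOfMeets φ)) where
  top_mem := ⟨{∅}, by simp [joinOfMeets]⟩
  inf_mem := by
    classical
    rintro _ ⟨S, rfl⟩ _ ⟨T, rfl⟩
    refine ⟨Set.image2 (· ∪ ·) S T, ?_⟩
    simp only [joinOfMeets, iSup_inf_eq, inf_iSup_eq, iSup_image2, Finset.inf_union]
    refine le_antisymm ?_ ?_
    · exact iSup₂_le fun s hs => iSup₂_le fun t ht =>
        le_iSup₂_of_le t ht (le_iSup₂_of_le s hs le_rfl)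
    · exact iSup₂_le fun t ht => iSup₂_le fun s hs =>
        le_iSup₂_of_le s hs (le_iSup₂_of_le t ht le_rfl)
  sSup_mem A hA := by
    refine ⟨⋃₀ {T | joinOfMeets φ T ∈ A}, le_antisymm ?_ (sSup_le fun a ha => ?_)⟩
    · refine iSup₂_le fun s ⟨T, hT, hs⟩ => le_trans ?_ (le_sSup hT)
      exact le_iSup₂_of_le s hs le_rfl
    · obtain ⟨T, rfl⟩ := hA ha
      exact iSup₂_le fun s hs => le_iSup₂_of_le s ⟨T, ha, hs⟩ le_rfl

/-- A small family of elements of a large frame lies in a small subframe which it generates. -/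
theorem exists_generated_subframe :
    ∃ (α : Type u) (_ : Order.Frame α) (i : FrameHom α β), Function.Injective i ∧
      (∀ g, φ g ∈ Set.range i) ∧ ∀ (γ : Type u) [Order.Frame γ] (h k : FrameHom α γ),
        (∀ a, i a ∈ Set.range φ → h a = k a) → h = k := by
  -- The subframe is parametrized by `Set (Finset G)`, hence is small even though `β` may be large.
  let e : Shrink.{u} (Set.range (joinOfMeets φ)) → β := fun a => ((equivShrink _).symm a).1
  have he : Function.Injective e := Subtype.val_injective.comp (equivShrink _).symm.injective
  have hrange : Set.range e = Set.range (joinOfMeets φ) :=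
    ((equivShrink _).symm.surjective.range_comp _).trans Subtype.range_coe
  have hr : IsSubframe (Set.range e) := by
    rw [hrange]
    exact isSubframe_range_joinOfMeets φ
  let i := homOfInjective e he hr
  have hφ : ∀ g, φ g ∈ Set.range e := fun g => by
    rw [hrange]
    exact ⟨{{g}}, by simp [joinOfMeets]⟩
  refine ⟨_, frameOfInjective e he hr, i, he, hφ, fun γ _ h k hk => ?_⟩
  let := frameOfInjective e he hr
  choose p hp using hφ
  have hp' : ∀ g, i (p g) = φ g := hp
  ext a
  obtain ⟨T, hT⟩ : i a ∈ Set.range (joinOfMeets φ) := hrange.subset ⟨a, rfl⟩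
  -- Injectivity pulls the expression in generators back to the small frame, so homomorphisms
  -- agreeing on generators agree.
  have ha : a = ⨆ s ∈ T, s.inf p := he <| by
    change i a = i _
    simp only [map_iSup, map_finset_inf, Function.comp_def, hp', ← hT, joinOfMeets]
  rw [ha]
  simp only [map_iSup, map_finset_inf, Function.comp_def]
  have hkp : ∀ g, h (p g) = k (p g) := fun g => hk _ ⟨g, (hp' g).symm⟩
  simp only [hkp]

end Generated

/-- Compatible families are closed under the coordinatewise frame operations, so they form a
subframe of the product. -/
instance Frm.hasLimits : HasLimits Frm.{u} where
  has_limits_of_shape J _ :=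
    { has_limit := fun F => by
        let S : Set (∀ j, F.obj j) := {x | ∀ ⦃j k : J⦄ (f : j ⟶ k), (F.map f).hom (x j) = x k}
        have hS : IsSubframe (Set.range (Subtype.val : S → ∀ j, F.obj j)) := by
          rw [Subtype.range_coe]
          refine ⟨fun j k f => map_top (F.map f).hom, fun x hx y hy j k f => ?_,
            fun A hA j k f => ?_⟩
          · exact (map_inf (F.map f).hom _ _).trans (congrArg₂ _ (hx f) (hy f))
          · rw [sSup_apply, sSup_apply, map_iSup]
            exact iSup_congr fun x => hA x.2 f
        let := frameOfInjective _ Subtype.val_injective hS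
        let i : FrameHom S (∀ j, F.obj j) := homOfInjective _ Subtype.val_injective hS
        have hi : Function.Injective i := Subtype.val_injective
        have hmem : ∀ x, x ∈ S → x ∈ Set.range i := fun x hx => ⟨⟨x, hx⟩, rfl⟩
        let c : Cone F :=
          { pt := Frm.of S
            π :=
              { app := fun j => Frm.ofHom ((evalHom j).comp i)
                naturality := fun j k f => Frm.ext fun x => (x.2 f).symm } }
        have hl : ∀ (s : Cone F) (x : s.pt), piHom (fun j => (s.π.app j).hom) x ∈ Set.range i :=
          fun s x => hmem _ fun j k f => by
            exact congrArg (fun g : s.pt ⟶ F.obj k => g.hom x) (s.w f)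
        exact ⟨⟨c,
          { lift := fun s => Frm.ofHom (codRestrict i hi _ (hl s))
            fac := fun s j => Frm.ext fun x => congrFun (codRestrict_spec i hi _ (hl s) x) j
            uniq := fun s m hm => Frm.ext fun x => hi <| funext fun j => by
              have h := congrFun (codRestrict_spec i hi _ (hl s) x) j
              refine Eq.trans ?_ h.symm
              exact congrArg (fun g : s.pt ⟶ F.obj j => g.hom x) (hm j) }⟩⟩ }

/-- In the large product of the vertices of all cocones, the elements of the diagram generate a
small subframe. The coordinate at a cocone gives the descent map, unique because it is determined on
generators. -/
instance Frm.hasColimits : HasColimits Frm.{u} where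
  has_colimits_of_shape J _ :=
    { has_colimit := fun F => by
        let φ : (Σ j, F.obj j) → ∀ c : Cocone F, c.pt := fun g c => (c.ι.app g.1).hom g.2
        obtain ⟨α, _, i, hi, hφ, hext⟩ := exists_generated_subframe φ
        have hl : ∀ (j : J) (x : F.obj j),
            piHom (fun c : Cocone F => (c.ι.app j).hom) x ∈ Set.range i := fun j x => hφ ⟨j, x⟩
        let ι : ∀ j, FrameHom (F.obj j) α := fun j => codRestrict i hi _ (hl j)
        have hι : ∀ j x (c : Cocone F), i (ι j x) c = (c.ι.app j).hom x := fun j x c =>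
          congrFun (codRestrict_spec i hi _ (hl j) x) c
        let c : Cocone F :=
          { pt := Frm.of α
            ι :=
              { app := fun j => Frm.ofHom (ι j)
                naturality := fun j k f => Frm.ext fun x => hi <| funext fun c => by
                  refine (hι k _ c).trans (Eq.trans ?_ (hι j x c).symm)
                  exact congrArg (fun g : F.obj j ⟶ c.pt => g.hom x) (c.w f) } }
        exact ⟨⟨c,
          { desc := fun s => Frm.ofHom ((evalHom s).comp i)
            fac := fun s j => Frm.ext fun x => hι j x s
            uniq := fun s m hm => Frm.hom_ext <| hext _ _ _ fun a ha => by
              obtain ⟨⟨j, x⟩, hx⟩ := ha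
              obtain rfl : ι j x = a := hi ((codRestrict_spec i hi _ (hl j) x).trans hx)
              refine Eq.trans ?_ (hι j x s).symm
              exact congrArg (fun g : F.obj j ⟶ s.pt => g.hom x) (hm j) }⟩⟩ }

/-! ### The category of overt locales -/

/-- Classically, an open is positive if and only if it is nonzero. -/
theorem isPositive_iff {L : Type*} [Order.Frame L] {a : L} : IsPositive a ↔ a ≠ ⊥ := by
  constructor
  · rintro h rfl
    exact Set.not_nonempty_empty (h ∅ bot_le)
  · intro h A hA
    by_contra hne
    rw [Set.not_nonempty_iff_eq_empty.1 hne, sSup_empty] at hA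
    exact h (le_bot_iff.1 hA)

/-- Classically, every locale is overt. -/
theorem isOvert (X : Locale.{u}) : IsOvert X := by
  intro a
  refine le_antisymm ?_ (sSup_le fun b hb => hb.1)
  by_cases ha : a = ⊥
  · exact ha ▸ bot_le
  · exact le_sSup ⟨le_rfl, isPositive_iff.2 ha⟩

instance : IsOvert.{u}.ι.IsEquivalence where
  essSurj := ⟨fun X => ⟨⟨X, isOvert X⟩, ⟨Iso.refl _⟩⟩⟩

instance : HasLimits Locale.{u} := inferInstanceAs (HasLimits Frm.{u}ᵒᵖ)

instance : HasColimits Locale.{u} := inferInstanceAs (HasColimits Frm.{u}ᵒᵖ)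

namespace OLoc

instance : HasLimits OLoc.{u} := Adjunction.has_limits_of_equivalence IsOvert.ι

instance : HasColimits OLoc.{u} := Adjunction.has_colimits_of_equivalence IsOvert.ι

/-- The morphism of overt locales with a given frame homomorphism. -/
def homMk {X Y : OLoc.{u}} (f : FrameHom Y.Opens X.Opens) : X ⟶ Y :=
  ObjectProperty.homMk (Quiver.Hom.op (Frm.ofHom f))

theorem hom_ext {X Y : OLoc.{u}} {f g : X ⟶ Y} (h : pullback f = pullback g) : f = g :=
  ObjectProperty.hom_ext _ (Quiver.Hom.unop_inj (Frm.hom_ext h))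

end OLoc

/-! ### Initial and final lifts -/

namespace PUnifLoc

theorem hom_ext {X Y : PUnifLoc.{u}} {f g : X ⟶ Y} (h : forget.map f = forget.map g) : f = g :=
  Hom.ext h

/-- A morphism of overt locales between pre-uniform locales is uniform if inverse images of
entourages are entourages. -/
def IsUniformMap {X Y : PUnifLoc.{u}} (f : X.toOLoc ⟶ Y.toOLoc) : Prop :=
  ∀ F ∈ Y.uniformity.entourages,
    prodMap (OLoc.pullback f) (OLoc.pullback f) F ∈ X.uniformity.entourages

theorem isUniformMap_of_eq {X Y : PUnifLoc.{u}} (g : X ⟶ Y) {h : X.toOLoc ⟶ Y.toOLoc}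
    (hg : h = forget.map g) : IsUniformMap h := by
  subst hg
  exact g.prodMap_mem

/-- The coarsest pre-uniform locale structure making a structured source uniform. -/
def initialLift {I : Type w} (X : I → PUnifLoc.{u}) {Y : OLoc.{u}}
    (f : ∀ i, Y ⟶ (X i).toOLoc) : PUnifLoc.{u} :=
  ⟨Y, .initial (fun i => (X i).uniformity) fun i => OLoc.pullback (f i)⟩

/-- The members of a structured source as morphisms out of the initial lift. -/
def initialLiftHom {I : Type w} (X : I → PUnifLoc.{u}) {Y : OLoc.{u}}
    (f : ∀ i, Y ⟶ (X i).toOLoc) (i : I) : initialLift X f ⟶ X i :=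
  ⟨f i, fun _ hF => Uniformity.mem_initial (A := fun i => (X i).Opens)
    (f := fun i => OLoc.pullback (f i)) i hF⟩

theorem isUniformMap_initialLift {I : Type w} {X : I → PUnifLoc.{u}} {Y : OLoc.{u}}
    {f : ∀ i, Y ⟶ (X i).toOLoc} {Z : PUnifLoc.{u}} {h : Z.toOLoc ⟶ Y}
    (hf : ∀ i, IsUniformMap (X := Z) (Y := X i) (h ≫ f i)) :
    IsUniformMap (X := Z) (Y := initialLift X f) h := fun _ hE =>
  Uniformity.prodMap_mem_of_mem_initial hf hE

theorem isInitialSource_initialLiftHom {I : Type w} (X : I → PUnifLoc.{u}) {Y : OLoc.{u}}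
    (f : ∀ i, Y ⟶ (X i).toOLoc) : IsInitialSource forget.{u} (initialLiftHom X f) := by
  intro Z g h hgh
  refine ⟨⟨h, isUniformMap_initialLift fun i => ?_⟩, ⟨rfl, fun i => ?_⟩, ?_⟩
  · exact isUniformMap_of_eq (g i) (hgh i).symm
  · exact hom_ext (hgh i).symm
  · exact fun k hk => hom_ext hk.1

/-- Testing each initial source against the other with the identity of `Y` shows that each
uniformity contains the other. -/
theorem eq_of_isInitialSource {I : Type w} {X : I → PUnifLoc.{u}} {Y : OLoc.{u}}
    {𝓔 𝓕 : Uniformity Y.Opens} {f : ∀ i, (⟨Y, 𝓔⟩ : PUnifLoc) ⟶ X i}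
    {g : ∀ i, (⟨Y, 𝓕⟩ : PUnifLoc) ⟶ X i} (hfg : ∀ i, (f i).toHom = (g i).toHom)
    (hf : IsInitialSource forget.{u} f) (hg : IsInitialSource forget.{u} g) : 𝓔 = 𝓕 := by
  have key : ∀ {𝓔 𝓕 : Uniformity Y.Opens} {f : ∀ i, (⟨Y, 𝓔⟩ : PUnifLoc) ⟶ X i}
      {g : ∀ i, (⟨Y, 𝓕⟩ : PUnifLoc) ⟶ X i}, (∀ i, (f i).toHom = (g i).toHom) →
      IsInitialSource forget.{u} g → ∀ F ∈ 𝓕.entourages, F ∈ 𝓔.entourages := by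
    intro 𝓔 𝓕 f g hfg hg F hF
    obtain ⟨k, ⟨hk, -⟩, -⟩ := hg ⟨Y, 𝓔⟩ f (𝟙 Y) fun i => (hfg i).trans (Category.id_comp _).symm
    have := k.prodMap_mem F hF
    have hk' : k.toHom = 𝟙 Y := hk
    rwa [hk', OLoc.pullback_id, prodMap_id] at this
  refine Uniformity.ext (SetLike.ext fun F => ?_)
  exact ⟨key (fun i => (hfg i).symm) hf F, key hfg hg F⟩

theorem initialLift_subsingleton {I : Type w} {X : I → PUnifLoc.{u}} {Y : OLoc.{u}}
    {f : ∀ i, Y ⟶ forget.obj (X i)} (A B : InitialLift forget X Y f) : A = B := by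
  obtain ⟨⟨Y, 𝓔⟩, rfl, a, ha, ha'⟩ := A
  obtain ⟨⟨Y', 𝓕⟩, hY', b, hb, hb'⟩ := B
  obtain rfl : Y' = Y := hY'
  have hab : ∀ i, (a i).toHom = (b i).toHom := fun i => (ha i).trans (hb i).symm
  obtain rfl := eq_of_isInitialSource hab ha' hb'
  obtain rfl : a = b := funext fun i => hom_ext (hab i)
  rfl

theorem isTopologicalFunctor_forget : IsTopologicalFunctor.{w} forget.{u} := fun _ X _ f =>
  ⟨{ default :=
      { obj := initialLift X f
        obj_eq := rfl
        hom := initialLiftHom X f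
        map_hom := fun _ => (Category.id_comp _).symm
        isInitial := isInitialSource_initialLiftHom X f }
     uniq := fun _ => initialLift_subsingleton _ _ }⟩

/-! ### Limits and colimits of pre-uniform locales -/

instance : HasLimits PUnifLoc.{u} where
  has_limits_of_shape J _ :=
    { has_limit := fun F => by
        let c := limit.cone (F ⋙ forget)
        let A : PUnifLoc.{u} := initialLift F.obj c.π.app
        have hw : ∀ {j k : J} (f : j ⟶ k),
            initialLiftHom F.obj c.π.app j ≫ F.map f = initialLiftHom F.obj c.π.app k :=
          fun f => hom_ext (c.w f)
        let c' : Cone F :=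
          { pt := A
            π :=
              { app := initialLiftHom F.obj c.π.app
                naturality := fun _ _ f => (Category.id_comp _).trans (hw f).symm } }
        have hfac : ∀ (s : Cone F) (j : J),
            limit.lift (F ⋙ forget) (forget.mapCone s) ≫ c.π.app j = forget.map (s.π.app j) :=
          fun s j => limit.lift_π (forget.mapCone s) j
        exact ⟨⟨c',
          { lift := fun s => ⟨limit.lift (F ⋙ forget) (forget.mapCone s),
              isUniformMap_initialLift fun j =>
                isUniformMap_of_eq (s.π.app j) (hfac s j)⟩
            fac := fun s j => hom_ext (hfac s j)
            uniq := fun s m hm => hom_ext <| limit.hom_ext fun j =>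
              Eq.trans (congrArg Hom.toHom (hm j)) (hfac s j).symm }⟩⟩ }

instance : HasColimits PUnifLoc.{u} where
  has_colimits_of_shape J _ :=
    { has_colimit := fun F => by
        let c := colimit.cocone (F ⋙ forget)
        -- The final uniformity is obtained as an initial one, along all maps out of the underlying
        -- colimit whose composites with the legs are uniform. This index type is large, which
        -- initial lifts permit; descent maps are members of this source.
        let I := {p : Σ Z : PUnifLoc.{u}, c.pt ⟶ Z.toOLoc //
          ∀ j, IsUniformMap (X := F.obj j) (Y := p.1) (c.ι.app j ≫ p.2)}
        let A : PUnifLoc.{u} := initialLift (fun i : I => i.1.1) fun i => i.1.2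
        let ι : ∀ j, F.obj j ⟶ A := fun j =>
          ⟨c.ι.app j, isUniformMap_initialLift fun i => i.2 j⟩
        let c' : Cocone F :=
          { pt := A
            ι :=
              { app := ι
                naturality := fun _ _ f =>
                  hom_ext ((c.w f).trans (Category.comp_id (c.ι.app _)).symm) } }
        have hfac : ∀ (s : Cocone F) (j : J),
            c.ι.app j ≫ colimit.desc (F ⋙ forget) (forget.mapCocone s) =
              forget.map (s.ι.app j) :=
          fun s j => colimit.ι_desc (forget.mapCocone s) j
        have hunif : ∀ (s : Cocone F) (j : J), IsUniformMap (X := F.obj j) (Y := s.pt)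
            (c.ι.app j ≫ colimit.desc (F ⋙ forget) (forget.mapCocone s)) := fun s j =>
          isUniformMap_of_eq (s.ι.app j) (hfac s j)
        exact ⟨⟨c',
          { desc := fun s => initialLiftHom (fun i : I => i.1.1) (fun i => i.1.2)
              ⟨⟨s.pt, colimit.desc (F ⋙ forget) (forget.mapCocone s)⟩, hunif s⟩
            fac := fun s j => hom_ext (hfac s j)
            uniq := fun s m hm => hom_ext <| colimit.hom_ext fun j =>
              Eq.trans (congrArg Hom.toHom (hm j)) (hfac s j).symm }⟩⟩ }

/-! ### The uniform reflection -/

variable (X : PUnifLoc.{u})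

/-- The frame of opens which are fixed by the core. -/
def CoreOpens : Type u := Function.fixedPoints X.uniformity.core

theorem isSubframe_range_coreOpens :
    IsSubframe (Set.range (Subtype.val : X.CoreOpens → X.Opens)) :=
  (Subtype.range_coe (s := Function.fixedPoints X.uniformity.core)).symm ▸
    X.uniformity.isConucleus_core.isSubframe_fixedPoints

noncomputable instance : Order.Frame X.CoreOpens :=
  frameOfInjective _ Subtype.val_injective X.isSubframe_range_coreOpens

/-- The inclusion of the frame of opens which are fixed by the core. -/
noncomputable def coreInclusion : FrameHom X.CoreOpens X.Opens :=
  homOfInjective _ Subtype.val_injective X.isSubframe_range_coreOpens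

theorem isCoreEmbedding_coreInclusion : IsCoreEmbedding X.uniformity X.coreInclusion where
  injective := Subtype.val_injective
  range_eq := Subtype.range_coe (s := Function.fixedPoints X.uniformity.core)

/-- The uniform reflection of a pre-uniform locale. -/
noncomputable def reflection : UnifLoc.{u} :=
  ⟨⟨⟨Locale.of X.CoreOpens, isOvert _⟩, X.isCoreEmbedding_coreInclusion.uniformity⟩,
    X.isCoreEmbedding_coreInclusion.isAdmissible⟩

/-- The unit of the uniform reflection. -/
noncomputable def reflectionUnit : X ⟶ X.reflection.obj where
  toHom := OLoc.homMk X.coreInclusion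
  prodMap_mem _ hF := X.isCoreEmbedding_coreInclusion.prodMap_mem hF

variable {X}

/-- The unit is an epimorphism of locales because its inverse image map is injective. -/
theorem reflectionUnit_comp_cancel {Z : OLoc.{u}} {h k : X.reflection.obj.toOLoc ⟶ Z}
    (hhk : X.reflectionUnit.toHom ≫ h = X.reflectionUnit.toHom ≫ k) : h = k := by
  refine OLoc.hom_ext (FrameHom.ext fun a => X.isCoreEmbedding_coreInclusion.injective ?_)
  exact congrArg (fun f : X.toOLoc ⟶ Z => OLoc.pullback f a) hhk

theorem isFinalMorphism_reflectionUnit : IsFinalMorphism forget.{u} X.reflectionUnit := by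
  intro Z g h hgh
  refine ⟨⟨h, ?_⟩, ⟨rfl, hom_ext hgh.symm⟩, fun k hk => hom_ext hk.1⟩
  exact X.isCoreEmbedding_coreInclusion.prodMap_mem_uniformity
    (isUniformMap_of_eq g (h := X.reflectionUnit.toHom ≫ h) hgh.symm)

/-- Admissibility of `Y` puts all inverse images among the fixed opens, which gives the
factorization of locales; finality of the unit makes it uniform. -/
theorem exists_reflectionUnit_comp {Y : PUnifLoc.{u}} (hY : IsUniform Y) (g : X ⟶ Y) :
    ∃ k : X.reflection.obj ⟶ Y, X.reflectionUnit ≫ k = g := by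
  have hg : ∀ b, pullback g b ∈ Set.range X.coreInclusion := fun b => by
    rw [X.isCoreEmbedding_coreInclusion.range_eq]
    exact hY.apply_mem_fixedPoints g.prodMap_mem b
  let h : X.reflection.obj.toOLoc ⟶ Y.toOLoc :=
    OLoc.homMk (codRestrict _ X.isCoreEmbedding_coreInclusion.injective _ hg)
  have hh : forget.map g = forget.map X.reflectionUnit ≫ h :=
    OLoc.hom_ext (FrameHom.ext fun b =>
      (codRestrict_spec _ X.isCoreEmbedding_coreInclusion.injective _ hg b).symm)
  obtain ⟨k, hk, -⟩ := isFinalMorphism_reflectionUnit Y g h hh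
  exact ⟨k, hk.2⟩

/-- The universal property of the uniform reflection. -/
noncomputable def reflectionEquiv (X : PUnifLoc.{u}) (Y : UnifLoc.{u}) :
    (X.reflection ⟶ Y) ≃ (X ⟶ UnifLoc.incl.obj Y) :=
  Equiv.ofBijective (fun k => X.reflectionUnit ≫ k.hom)
    ⟨fun _ _ h => ObjectProperty.hom_ext _ (hom_ext (reflectionUnit_comp_cancel
        (congrArg Hom.toHom h))), fun g => by
      obtain ⟨k, hk⟩ := exists_reflectionUnit_comp Y.property g
      exact ⟨ObjectProperty.homMk k, hk⟩⟩

/-- Uniform locales are reflective in pre-uniform locales. -/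
@[reducible]
noncomputable def reflectiveIncl : Reflective UnifLoc.incl.{u} where
  L := Adjunction.leftAdjointOfEquiv (G := UnifLoc.incl.{u}) reflectionEquiv fun _ _ _ _ _ => rfl
  adj := Adjunction.adjunctionOfEquivLeft (G := UnifLoc.incl.{u}) reflectionEquiv
    fun _ _ _ _ _ => rfl

theorem unit_reflectiveIncl (X : PUnifLoc.{u}) :
    letI := reflectiveIncl.{u}
    (reflectorAdjunction UnifLoc.incl.{u}).unit.app X = X.reflectionUnit :=
  Category.comp_id X.reflectionUnit

end PUnifLoc

end PointfreeUniformity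

theorem mainTheorem3 :
    (∀ X : PUnifLoc.{u},
      IsConucleus X.uniformity.core ∧
      IsSubframe {b : X.Opens | b = sSup {a | X.uniformity.UniformlyBelow a b}} ∧
      {b : X.Opens | b = sSup {a | X.uniformity.UniformlyBelow a b}} =
        Function.fixedPoints X.uniformity.core) ∧
    (∃ _ : Reflective UnifLoc.incl.{u}, ∀ X : PUnifLoc.{u},
      Function.Injective
        (PUnifLoc.pullback ((reflectorAdjunction UnifLoc.incl.{u}).unit.app X)) ∧
      Set.range (PUnifLoc.pullback ((reflectorAdjunction UnifLoc.incl.{u}).unit.app X)) =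
        {b : X.Opens | b = sSup {a | X.uniformity.UniformlyBelow a b}} ∧
      IsFinalMorphism PUnifLoc.forget.{u}
        ((reflectorAdjunction UnifLoc.incl.{u}).unit.app X)) ∧
    IsTopologicalFunctor.{w} PUnifLoc.forget.{u} ∧
    (HasLimits OLoc.{u} ∧ HasColimits OLoc.{u}) ∧
    (HasLimits PUnifLoc.{u} ∧ HasColimits PUnifLoc.{u}) ∧
    (HasLimits UnifLoc.{u} ∧ HasColimits UnifLoc.{u}) := by
  refine ⟨fun X => ⟨X.uniformity.isConucleus_core, ?_, X.uniformity.setOf_eq_fixedPoints⟩,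
    ⟨PUnifLoc.reflectiveIncl, fun X => ?_⟩, PUnifLoc.isTopologicalFunctor_forget,
    ⟨inferInstance, inferInstance⟩, ⟨inferInstance, inferInstance⟩, ?_⟩
  · rw [X.uniformity.setOf_eq_fixedPoints]
    exact X.uniformity.isConucleus_core.isSubframe_fixedPoints
  · rw [PUnifLoc.unit_reflectiveIncl X]
    exact ⟨X.isCoreEmbedding_coreInclusion.injective,
      X.isCoreEmbedding_coreInclusion.range_eq.trans X.uniformity.setOf_eq_fixedPoints.symm,
      PUnifLoc.isFinalMorphism_reflectionUnit⟩
  · let := PUnifLoc.reflectiveIncl.{u}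
    exact ⟨hasLimits_of_reflective UnifLoc.incl, hasColimits_of_reflective UnifLoc.incl⟩
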